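/- Fix an o-minimal structure over the field $\mathbb R$; all sets and maps are definable in it, and the empty set counts as connected. **Definitions.** A *coordinate cone* in $\mathbb R^m$ is a set given by finitely many conditions $x_{j}\,\sigma_j\,c_j$ on distinct coordinates, with $\sigma_j\in\{<,=,>\}$, $c_j\in\mathbb R$. An open bounded (possibly empty) set $X\subset\mathbb R^m$ is *semi-monotone* if $X\cap C$ is connected for every coordinate cone $C$. A bounded upper semi-continuous function $f$ on a non-empty semi-monotone set $X$ is *submonotone* if $\{x\in X: f(x)<b\}$ is semi-monotone for every $b\in\mathbb R$, and *supermonotone* means that $-f$ is submonotone. A function on $X$ is *monotone* if it is both sub- and supermonotone and, for each coordinate $x_j$, is strictly increasing in, strictly decreasing in, or independent of $x_j$. Let $\mathbf f=(f_1,\dots,f_k):X\to\mathbb R^k$ be a bounded continuous map on a non-empty open bounded set $X\subset\mathbb R^n$ with graph $\mathbf F\subset\mathbb R^{n+k}$, with coordinates $x_1,\dots,x_n,y_1,\dots,y_k$. For a set $H$ of coordinates let $\rho_H$ be the projection of $\mathbf F$ to the space of the coordinates in $H$. A set $H$ with $|H|=n$ is a *basis set* of $\mathbf f$ if $\rho_H$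 is injective. The map $\mathbf f$ is *quasi-affine* if for every set $H$ of $n$ coordinates, $\rho_H$ is injective if and only if $\rho_H(\mathbf F)$ is $n$-dimensional. If $X$ is semi-monotone, $\mathbf f$ is *monotone* in the following inductive sense. If $n=0$, it is always monotone. If $n=1$, it is monotone when each $f_i$ is a monotone function. If $n\ge 2$, it is monotone when for all $i,j$ such that $f_i$ is not independent of $x_j$: for every $b\in\mathbb R$ the set $\mathbf F\cap\{y_i=b\}$, if non-empty, considered in the space of the coordinates other than $y_i$, is the graph of a monotone map $\mathbf f_{i,j,b}$ from a semi-monotone set in the space of the coordinates $x_1,\dots,x_n$ without $x_j$ to the space of $y_1,\dots,y_k$ with $y_i$ replaced by $x_j$; and the system of basis sets of $\mathbf f_{i,j,b}$ does not depend on $b$. A set in a coordinate space is called *the graph of a monotone map* if it is the graph of a monotone map for some division of the coordinates into coordinates of the domain and coordinates of the target. **Theorem.** Let $\mathbf f=(f_1,\dots,f_k)$ be a bounded continuous quasi-affine map on a non-empty semi-monotone set $X\subset\mathbb R^n$, with graph $\mathbf F\subset\mathbb R^{n+k}$. Let $Z\subset\{x_1,\dots,x_n,y_1,\dots,y_k\}$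 be a set of $k$ coordinates and let $T$ be the set of the remaining $n$ coordinates. Assume that $\rho_T(\mathbf F)$ is $n$-dimensional, so that $\rho_T$ is injective and every coordinate is a function on $\rho_T(\mathbf F)$. Then $\mathbf f$ is monotone if and only if both of the following hold: 1. $\rho_T(\mathbf F)$ is a semi-monotone set. 2. For every $x_j\in Z$ and every $a\in\mathbb R$, the intersection $\mathbf F\cap\{x_j=a\}$, considered in the space of the coordinates other than $x_j$, is either empty or the graph of a monotone map. For every $y_i\in Z$ which, as a function on $\rho_T(\mathbf F)$, is not independent of some variable in $T$, and every $a\in\mathbb R$, the intersection $\mathbf F\cap\{y_i=a\}$, considered in the space of the coordinates other than $y_i$, is either empty or the graph of a monotone map. -/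

import Mathlib

/-- An o-minimal structure over the field of real numbers: a family of collections of subsets of
`ℝⁿ` (the definable sets), containing the real algebraic sets, closed under Boolean operations,
products and coordinate projections, and such that the definable subsets of the line are exactly
the finite unions of intervals and points (an order-connected subset of `ℝ` is an interval of
any kind, a point, or empty). -/
structure OMinimalStructure where
  definable : (n : ℕ) → Set (Set (Fin n → ℝ))
  algebraic : ∀ (n : ℕ) (P : MvPolynomial (Fin n) ℝ), {x | MvPolynomial.eval x P = 0} ∈ definable n
  union : ∀ (n : ℕ) (A B : Set (Fin n → ℝ)), A ∈ definable n → B ∈ definable n →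
    A ∪ B ∈ definable n
  inter : ∀ (n : ℕ) (A B : Set (Fin n → ℝ)), A ∈ definable n → B ∈ definable n →
    A ∩ B ∈ definable n
  compl : ∀ (n : ℕ) (A : Set (Fin n → ℝ)), A ∈ definable n → Aᶜ ∈ definable n
  prod : ∀ (m n : ℕ) (A : Set (Fin m → ℝ)) (B : Set (Fin n → ℝ)), A ∈ definable m →
    B ∈ definable n →
    {p : Fin (m + n) → ℝ | (fun i => p (Fin.castAdd n i)) ∈ A ∧ (fun i => p (Fin.natAdd m i)) ∈ B}
      ∈ definable (m + n)
  proj : ∀ (n : ℕ) (A : Set (Fin (n + 1) → ℝ)), A ∈ definable (n + 1) →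
    (fun (p : Fin (n + 1) → ℝ) (i : Fin n) => p i.castSucc) '' A ∈ definable n
  ominimal : ∀ A : Set (Fin 1 → ℝ), A ∈ definable 1 ↔
    ∃ 𝓘 : Set (Set ℝ), 𝓘.Finite ∧ (∀ I ∈ 𝓘, I.OrdConnected) ∧ A = {x | x 0 ∈ ⋃₀ 𝓘}

/-- Coordinate cones in `ℝ^ι`: finitely many distinct coordinates `x_j` are each compared with a
constant `c_j` by one of `<`, `=`, `>` (the sign `σ_j` of `x_j - c_j` is prescribed). -/
def IsCoordinateCone {ι : Type} (C : Set (ι → ℝ)) : Prop :=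
  ∃ (J : Finset ι) (σ : ι → SignType) (c : ι → ℝ),
    C = {x | ∀ j ∈ J, SignType.sign (x j - c j) = σ j}

/-- Semi-monotone sets: open, bounded (possibly empty) sets all of whose intersections with
coordinate cones are connected, where the empty set counts as connected. Definability is a
standing assumption, made on the ambient data; it passes to all sets to which this is applied. -/
def IsSemiMonotone {ι : Type} [Fintype ι] (X : Set (ι → ℝ)) : Prop :=
  IsOpen X ∧ Bornology.IsBounded X ∧
    ∀ C : Set (ι → ℝ), IsCoordinateCone C → IsPreconnected (X ∩ C)

/-- A set in `ℝ^ι`, where `ι` has `n` elements, is `n`-dimensional if it has an interior point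
(for definable sets: if it contains an open cell). -/
def IsFullDimensional {ι : Type} [Fintype ι] (A : Set (ι → ℝ)) : Prop :=
  (interior A).Nonempty

/-- The function `φ` on `X` is independent of the coordinate `x_j`. -/
def IsIndependentOf {ι : Type} (X : Set (ι → ℝ)) (φ : (ι → ℝ) → ℝ) (j : ι) : Prop :=
  ∀ x ∈ X, ∀ y ∈ X, (∀ l, l ≠ j → x l = y l) → φ x = φ y

/-- The function `φ` on `X` is strictly increasing in the coordinate `x_j`. -/
def IsStrictlyIncreasingIn {ι : Type} (X : Set (ι → ℝ)) (φ : (ι → ℝ) → ℝ) (j : ι) : Prop :=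
  ∀ x ∈ X, ∀ y ∈ X, (∀ l, l ≠ j → x l = y l) → x j < y j → φ x < φ y

/-- The function `φ` on `X` is strictly decreasing in the coordinate `x_j`. -/
def IsStrictlyDecreasingIn {ι : Type} (X : Set (ι → ℝ)) (φ : (ι → ℝ) → ℝ) (j : ι) : Prop :=
  ∀ x ∈ X, ∀ y ∈ X, (∀ l, l ≠ j → x l = y l) → x j < y j → φ y < φ x

/-- Submonotone functions on a non-empty semi-monotone set. -/
def IsSubmonotone {ι : Type} [Fintype ι] (X : Set (ι → ℝ)) (φ : (ι → ℝ) → ℝ) : Prop :=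
  X.Nonempty ∧ IsSemiMonotone X ∧ Bornology.IsBounded (φ '' X) ∧ UpperSemicontinuousOn φ X ∧
    ∀ b : ℝ, IsSemiMonotone {x ∈ X | φ x < b}

/-- Supermonotone functions. -/
def IsSupermonotone {ι : Type} [Fintype ι] (X : Set (ι → ℝ)) (φ : (ι → ℝ) → ℝ) : Prop :=
  IsSubmonotone X (fun x => -φ x)

/-- Monotone functions on a non-empty semi-monotone set. -/
def IsMonotoneFunction {ι : Type} [Fintype ι] (X : Set (ι → ℝ)) (φ : (ι → ℝ) → ℝ) : Prop :=
  IsSubmonotone X φ ∧ IsSupermonotone X φ ∧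
    ∀ j, IsStrictlyIncreasingIn X φ j ∨ IsStrictlyDecreasingIn X φ j ∨ IsIndependentOf X φ j

/-- `G ⊆ ℝ^ι` is the graph of a map `f` from the subset `D.restrict '' G` of `span D` to `span E`.
Here `D` and `E` are disjoint sets of coordinates; all other coordinates have to be
constant on `G`, so that `G` lies in an affine coordinate subspace, which is identified with
`span (D ∪ E)`. `D.restrict : (ι → ℝ) → (D → ℝ)` is the projection to `span D`. -/
def IsGraphOfMap {ι : Type} [DecidableEq ι] (D E : Finset ι) (f : (D → ℝ) → (E → ℝ))
    (G : Set (ι → ℝ)) : Prop :=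
  Disjoint D E ∧ (∀ p ∈ G, E.restrict p = f (D.restrict p)) ∧
    ∀ p ∈ G, ∀ q ∈ G, ∀ c, c ∉ D ∪ E → p c = q c

/-- The system of basis sets of a map from a subset of `span D` to `span E` with graph `G`: the
sets `H` of `|D|` of the coordinates in `D ∪ E` such that the projection of `G` to `span H`
is injective. -/
def basisSets {ι : Type} [DecidableEq ι] (D E : Finset ι) (G : Set (ι → ℝ)) : Set (Finset ι) :=
  {H | H ⊆ D ∪ E ∧ H.card = D.card ∧ Set.InjOn (H.restrict (π := fun _ => ℝ)) G}

/-- `G` is the graph of a monotone map from a non-empty semi-monotone subset of `span D` to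
`span E`, where `n` is the number of coordinates in `D`; by induction on `n`.
Every map on the one-point space `ℝ⁰` is monotone. In the case `n ≥ 2`, for a component `f i` not
independent of the coordinate `j`, the intersection `G ∩ {y_i = b}` has to be the graph of a
monotone map from a subset of `span (D \ {j})` to `span ((E \ {i}) ∪ {j})`, with a system of basis
sets that does not depend on `b`. -/
def IsMonotoneGraphAux {ι : Type} [DecidableEq ι] :
    ℕ → Finset ι → Finset ι → Set (ι → ℝ) → Prop
  | 0, D, E, G => ∃ f : (D → ℝ) → (E → ℝ),
      IsGraphOfMap D E f G ∧ (D.restrict '' G).Nonempty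
  | 1, D, E, G => ∃ f : (D → ℝ) → (E → ℝ),
      IsGraphOfMap D E f G ∧ (D.restrict '' G).Nonempty ∧ IsSemiMonotone (D.restrict '' G) ∧
      ContinuousOn f (D.restrict '' G) ∧ Bornology.IsBounded (f '' (D.restrict '' G)) ∧
      ∀ i : E, IsMonotoneFunction (D.restrict '' G) (fun x => f x i)
  | n + 2, D, E, G => ∃ f : (D → ℝ) → (E → ℝ),
      IsGraphOfMap D E f G ∧ (D.restrict '' G).Nonempty ∧ IsSemiMonotone (D.restrict '' G) ∧
      ContinuousOn f (D.restrict '' G) ∧ Bornology.IsBounded (f '' (D.restrict '' G)) ∧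
      ∀ (i : E) (j : D), ¬ IsIndependentOf (D.restrict '' G) (fun x => f x i) j →
        (∀ b : ℝ, (G ∩ {p | p i = b}).Nonempty →
          IsMonotoneGraphAux (n + 1) (D.erase j) (insert (j : ι) (E.erase i))
            (G ∩ {p | p i = b})) ∧
        (∀ b b' : ℝ, (G ∩ {p | p i = b}).Nonempty → (G ∩ {p | p i = b'}).Nonempty →
          basisSets (D.erase j) (insert (j : ι) (E.erase i)) (G ∩ {p | p i = b}) =
            basisSets (D.erase j) (insert (j : ι) (E.erase i)) (G ∩ {p | p i = b'}))

/-- `G` is the graph of a monotone map from a non-empty semi-monotone subset of `span D` to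
`span E`. -/
def IsMonotoneGraph {ι : Type} [DecidableEq ι] (D E : Finset ι) (G : Set (ι → ℝ)) : Prop :=
  IsMonotoneGraphAux D.card D E G

/-- `G`, considered as a set in `span A`, is the graph of a monotone map: the coordinates in `A`
can be divided into coordinates `D` of the domain and coordinates `A \ D` of the target. -/
def IsGraphOfMonotoneMapIn {ι : Type} [DecidableEq ι] (A : Finset ι) (G : Set (ι → ℝ)) : Prop :=
  ∃ D ⊆ A, IsMonotoneGraph D (A \ D) G

/-- The graph of `f` on `X ⊆ ℝⁿ`, a set in `ℝ^(n+k)`, with coordinates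
`x_j = Sum.inl j` and `y_i = Sum.inr i`. -/
def mapGraph {n k : ℕ} (X : Set (Fin n → ℝ)) (f : (Fin n → ℝ) → (Fin k → ℝ)) :
    Set (Fin n ⊕ Fin k → ℝ) :=
  {p | ∃ x ∈ X, p = Sum.elim x (f x)}

/-- `f` on `X` is definable: its graph, as a subset of `ℝ^(n+k)`, is definable. -/
def OMinimalStructure.IsDefinableMap (S : OMinimalStructure) {n k : ℕ} (X : Set (Fin n → ℝ))
    (f : (Fin n → ℝ) → (Fin k → ℝ)) : Prop :=
  {p : Fin (n + k) → ℝ | ∃ x ∈ X, p = Fin.append x (f x)} ∈ S.definable (n + k)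

/-- `f : X → ℝᵏ` is a monotone map. -/
def IsMonotoneMap {n k : ℕ} (X : Set (Fin n → ℝ)) (f : (Fin n → ℝ) → (Fin k → ℝ)) : Prop :=
  IsMonotoneGraph (Finset.univ.map Function.Embedding.inl)
    (Finset.univ.map Function.Embedding.inr) (mapGraph X f)

/-- `f : X → ℝᵏ` is quasi-affine: for any choice `H` of `n` of the coordinates, the projection of
the graph to `span H` is injective if and only if its image is `n`-dimensional. -/
def IsQuasiAffine {n k : ℕ} (X : Set (Fin n → ℝ)) (f : (Fin n → ℝ) → (Fin k → ℝ)) : Prop :=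
  ∀ H : Finset (Fin n ⊕ Fin k), H.card = n →
    (Set.InjOn (H.restrict (π := fun _ => ℝ)) (mapGraph X f) ↔
      IsFullDimensional (H.restrict '' mapGraph X f))

/-- Suppose that the projection of `G` to `span T` is injective, so that each coordinate `z` is a
function on the image of `G` in `span T`. This says that this function is independent of
the variable `t`. -/
def IsIndependentOver {ι : Type} (T : Finset ι) (G : Set (ι → ℝ)) (z t : ι) : Prop :=
  ∀ p ∈ G, ∀ q ∈ G, (∀ s ∈ T, s ≠ t → p s = q s) → p z = q z

/-! Both sides of the equivalence amount to one property that treats all n + k coordinates alike: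
the graph `G` has connected intersection with every coordinate cone of the whole space
(`IsConeConnected Finset.univ G`).

A chart is a set of coordinates onto whose span `G` projects homeomorphically with open image. If
over a chart `H` a coordinate `h` depends locally on `t ∈ H`, the intermediate value theorem shows
that the projection with `t` replaced by `h` has interior points. By quasi-affinity it is then
injective, and so again a chart. A level set `{p | p z = b}` inherits such an exchange-closed system
by contraction of `z`, and the contracted system does not depend on `b`. This allows induction on
the dimension by slicing.

The core is `isConeConnected_univ`, which passes from cones in the coordinates of one chart to all
cones, given the same property for the level sets of non-constant coordinates outside the chart.
Equalities in a cone lead to slices. A strict inequality on a coordinate outside the chart is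
handled by viewing that coordinate as an open function with connected fibres, which pulls open
intervals back to connected sets. Hence graphs of monotone maps are cone-connected. Conversely,
`isMonotoneGraphAux_of_isConeConnected` makes a cone-connected `G` the graph of a monotone map over
each of its charts, whether the domain coordinates or `T`, and likewise for its slices. -/

open Set Filter Topology

/-! ### Charts and the exchange of one coordinate -/

/-- The projection of `G` to `span H` is injective and has local lifts: a homeomorphism from `G`
onto an open set, written in terms of points of `ℝ^ι`. -/
structure IsChart {ι : Type} [Fintype ι] (H : Finset ι) (G : Set (ι → ℝ)) : Prop where
  inj : ∀ p ∈ G, ∀ q ∈ G, (∀ h ∈ H, p h = q h) → p = q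
  lift : ∀ p ∈ G, ∀ ε > 0, ∃ δ > 0, ∀ u : ι → ℝ, (∀ h ∈ H, |u h - p h| < δ) →
    ∃ q ∈ G, (∀ h ∈ H, q h = u h) ∧ dist q p < ε

/-- On `G`, over the coordinates `H`, the coordinate `h` fails to be locally constant along the
lines parallel to the axis of `t ∈ H`. -/
def IsLocallyDependent {ι : Type} (H : Finset ι) (G : Set (ι → ℝ)) (h t : ι) : Prop :=
  ∃ p ∈ G, ∀ δ > 0, ∃ q ∈ G, (∀ s ∈ H, s ≠ t → q s = p s) ∧ |q t - p t| < δ ∧ q h ≠ p h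

theorem finset_restrict_eq_iff {ι : Type} {H : Finset ι} {p q : ι → ℝ} :
    H.restrict p = H.restrict q ↔ ∀ h ∈ H, p h = q h := by
  constructor
  · intro h i hi
    exact congrFun h ⟨i, hi⟩
  · intro h
    ext ⟨i, hi⟩
    exact h i hi

theorem injOn_restrict_iff {ι : Type} {H : Finset ι} {G : Set (ι → ℝ)} :
    InjOn (H.restrict (π := fun _ => ℝ)) G ↔
      ∀ p ∈ G, ∀ q ∈ G, (∀ h ∈ H, p h = q h) → p = q := by
  constructor
  · intro h p hp q hq hpq
    exact h hp hq (finset_restrict_eq_iff.2 hpq)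
  · intro h p hp q hq hpq
    exact h p hp q hq (finset_restrict_eq_iff.1 hpq)

/-- A projection that contains a box is full-dimensional. -/
theorem isFullDimensional_of_box {ι : Type} [DecidableEq ι] {H : Finset ι} {G : Set (ι → ℝ)} (u₀ : ι → ℝ) {δ : ℝ}
    (hδ : 0 < δ) (h : ∀ u : ι → ℝ, (∀ s ∈ H, |u s - u₀ s| < δ) → ∃ r ∈ G, ∀ s ∈ H, r s = u s) :
    IsFullDimensional (H.restrict '' G) := by
  refine ⟨H.restrict u₀, ?_⟩
  rw [mem_interior_iff_mem_nhds, Metric.mem_nhds_iff]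
  refine ⟨δ, hδ, fun x hx => ?_⟩
  obtain ⟨r, hr, hru⟩ := h (fun i => if hi : i ∈ H then x ⟨i, hi⟩ else 0) (by
    intro s hs
    simp only [hs, dif_pos]
    exact lt_of_le_of_lt (dist_le_pi_dist x (H.restrict u₀) ⟨s, hs⟩) hx)
  refine ⟨r, hr, ?_⟩
  ext ⟨i, hi⟩
  have := hru i hi
  simpa [hi] using this

namespace IsChart

variable {ι : Type} [Fintype ι] {H : Finset ι} {G : Set (ι → ℝ)}

/-- By injectivity the local lift of the `H`-coordinates of `q y` is `q y` itself, so closeness of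
these coordinates forces closeness of all others. -/
theorem continuousOn {X : Type*} [TopologicalSpace X] {s : Set X} {q : X → ι → ℝ}
    (hG : IsChart H G) (hq : ∀ x ∈ s, q x ∈ G)
    (hc : ∀ h ∈ H, ContinuousOn (fun x => q x h) s) : ContinuousOn q s := by
  intro x hx
  rw [ContinuousWithinAt, Metric.tendsto_nhds]
  intro ε hε
  obtain ⟨δ, hδ, hl⟩ := hG.lift (q x) (hq x hx) ε hε
  have h1 : ∀ᶠ y in 𝓝[s] x, ∀ h ∈ H, |q y h - q x h| < δ := by
    rw [Filter.eventually_all_finset]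
    intro h hh
    exact (Metric.tendsto_nhds.1 (hc h hh x hx)) δ hδ
  filter_upwards [h1, self_mem_nhdsWithin] with y hy hys
  obtain ⟨r, hr, hru, hrd⟩ := hl (q y) hy
  rwa [hG.inj r hr (q y) (hq y hys) hru] at hrd

variable [DecidableEq ι]

/-- If `h` takes values below and above `v` on a short segment parallel to the axis of `t`, then
all values close to `v` are taken on the nearby segments. -/
theorem exists_of_between (hG : IsChart H G) {t h : ι} (ht : t ∈ H) {p : ι → ℝ}
    {ε δ₀ : ℝ} (hδ₀ : 0 < δ₀)
    (hl : ∀ u : ι → ℝ, (∀ s ∈ H, |u s - p s| < δ₀) → ∃ q ∈ G, (∀ s ∈ H, q s = u s) ∧ dist q p < ε)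
    {q₀ q₁ : ι → ℝ} (h₀ : q₀ ∈ G) (h₁ : q₁ ∈ G)
    (e₀ : ∀ s ∈ H, s ≠ t → q₀ s = p s) (e₁ : ∀ s ∈ H, s ≠ t → q₁ s = p s)
    (d₀ : |q₀ t - p t| < δ₀) (d₁ : |q₁ t - p t| < δ₀) {v : ℝ} (v₀ : q₀ h < v) (v₁ : v < q₁ h) :
    ∃ δ > 0, ∀ u : ι → ℝ, (∀ s ∈ H, s ≠ t → |u s - p s| < δ) → |u h - v| < δ →
      ∃ r ∈ G, (∀ s ∈ H, s ≠ t → r s = u s) ∧ r h = u h ∧ dist r p < ε := by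
  obtain ⟨a₀, ha₀, l₀⟩ := hG.lift q₀ h₀ ((v - q₀ h) / 2) (by linarith)
  obtain ⟨a₁, ha₁, l₁⟩ := hG.lift q₁ h₁ ((q₁ h - v) / 2) (by linarith)
  -- Half of each gap is left for moving the end points and half for moving `v`, so `u h` stays
  -- between the two end values.
  refine ⟨min (min δ₀ (min a₀ a₁)) (min ((v - q₀ h) / 2) ((q₁ h - v) / 2)), ?_, ?_⟩
  · simp only [gt_iff_lt, lt_min_iff]
    refine ⟨⟨hδ₀, ha₀, ha₁⟩, by linarith, by linarith⟩
  intro u hu huv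
  simp only [lt_min_iff] at hu huv
  have key : ∀ x ∈ uIcc (q₀ t) (q₁ t), ∃ r ∈ G,
      (∀ s ∈ H, r s = Function.update u t x s) ∧ dist r p < ε := by
    intro x hx
    apply hl
    intro s hs
    by_cases hst : s = t
    · subst hst
      rw [Function.update_self]
      rw [abs_lt] at d₀ d₁ ⊢
      rcases mem_uIcc.1 hx with hx | hx <;> constructor <;> linarith [hx.1, hx.2]
    · rw [Function.update_of_ne hst]
      exact (hu s hs hst).1.1
  choose! r hrG hru hrd using key
  have hcont : ContinuousOn r (uIcc (q₀ t) (q₁ t)) := by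
    apply hG.continuousOn hrG
    intro s hs
    by_cases hst : s = t
    · subst hst
      exact continuousOn_id.congr fun x hx => by simp [hru x hx s hs]
    · exact (continuousOn_const (c := u s)).congr fun x hx => by simp [hru x hx s hs, hst]
  -- Over the shifted segment the lift of each end point stays close to the original end point, by
  -- the chart property there.
  have endpt : ∀ {q : ι → ℝ} {a e : ℝ}, q t ∈ uIcc (q₀ t) (q₁ t) → 0 < a →
      (∀ w : ι → ℝ, (∀ s ∈ H, |w s - q s| < a) → ∃ r ∈ G, (∀ s ∈ H, r s = w s) ∧ dist r q < e) →
      (∀ s ∈ H, s ≠ t → q s = p s) → (∀ s ∈ H, s ≠ t → |u s - p s| < a) →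
      |r (q t) h - q h| < e := by
    intro q a e hq ha l eq hua
    obtain ⟨r', hr'G, hr'u, hr'd⟩ := l (Function.update u t (q t)) (by
      intro s hs
      by_cases hst : s = t
      · subst hst; simpa using ha
      · rw [Function.update_of_ne hst, eq s hs hst]; exact hua s hs hst)
    have : r' = r (q t) := hG.inj _ hr'G _ (hrG _ hq) fun s hs => by
      rw [hr'u s hs, hru _ hq s hs]
    rw [this] at hr'd
    exact lt_of_le_of_lt (dist_le_pi_dist (r (q t)) q h) hr'd
  have k₀ := endpt left_mem_uIcc ha₀ l₀ e₀ fun s hs hst => (hu s hs hst).1.2.1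
  have k₁ := endpt right_mem_uIcc ha₁ l₁ e₁ fun s hs hst => (hu s hs hst).1.2.2
  have hv := huv.2
  rw [abs_lt] at k₀ k₁
  have hlo := (abs_lt.1 hv.1).1
  have hhi := (abs_lt.1 hv.2).2
  have hmem : u h ∈ uIcc (r (q₀ t) h) (r (q₁ t) h) :=
    Icc_subset_uIcc ⟨by linarith [k₀.2], by linarith [k₁.1]⟩
  obtain ⟨x, hx, hxu⟩ := intermediate_value_uIcc (f := fun x => r x h)
    ((continuous_apply h).comp_continuousOn hcont) hmem
  refine ⟨r x, hrG x hx, fun s hs hst => ?_, hxu, hrd x hx⟩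
  rw [hru x hx s hs, Function.update_of_ne hst]

/-- The lifts of a segment parallel to the axis of `t`. -/
theorem exists_segment (hG : IsChart H G) {t : ι} {p : ι → ℝ}
    {ε δ₀ : ℝ} (hδ₀ : 0 < δ₀)
    (hl : ∀ u : ι → ℝ, (∀ s ∈ H, |u s - p s| < δ₀) → ∃ q ∈ G, (∀ s ∈ H, q s = u s) ∧ dist q p < ε)
    {d : ℝ} (hd : d < δ₀) :
    ∃ r : ℝ → ι → ℝ, ContinuousOn r (Icc (p t - d) (p t + d)) ∧
      ∀ x ∈ Icc (p t - d) (p t + d), r x ∈ G ∧ ∀ s ∈ H, r x s = Function.update p t x s := by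
  have key : ∀ x ∈ Icc (p t - d) (p t + d), ∃ r ∈ G,
      (∀ s ∈ H, r s = Function.update p t x s) ∧ dist r p < ε := by
    intro x hx
    apply hl
    intro s hs
    by_cases hst : s = t
    · subst hst
      rw [Function.update_self, abs_lt]
      constructor <;> linarith [hx.1, hx.2]
    · rw [Function.update_of_ne hst]
      simpa using hδ₀
  choose! r hrG hru hrd using key
  refine ⟨r, ?_, fun x hx => ⟨hrG x hx, hru x hx⟩⟩
  apply hG.continuousOn hrG
  intro s hs
  by_cases hst : s = t
  · subst hst
    exact continuousOn_id.congr fun x hx => by simp [hru x hx s hs]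
  · exact (continuousOn_const (c := p s)).congr fun x hx => by simp [hru x hx s hs, hst]

/-- On a short segment through `p` parallel to the axis of `t`, the coordinate `h` is continuous
and, by the assumed injectivity, injective. It is therefore strictly monotone, so `p h` lies
strictly between the end values and all nearby values are attained. -/
theorem exchange (hG : IsChart H G) {t h : ι} (ht : t ∈ H)
    (hinj : ∀ p ∈ G, ∀ q ∈ G, (∀ s ∈ insert h (H.erase t), p s = q s) → p = q) :
    IsChart (insert h (H.erase t)) G := by
  refine ⟨hinj, ?_⟩
  intro p hp ε hε
  obtain ⟨δ₀, hδ₀, hl⟩ := hG.lift p hp ε hε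
  obtain ⟨r, hrc, hr⟩ := hG.exists_segment (t := t) hδ₀ hl (d := δ₀ / 2) (by linarith)
  have hp_mem : p t ∈ Icc (p t - δ₀ / 2) (p t + δ₀ / 2) := ⟨by linarith, by linarith⟩
  have hl_mem : p t - δ₀ / 2 ∈ Icc (p t - δ₀ / 2) (p t + δ₀ / 2) := ⟨by linarith, by linarith⟩
  have hr_mem : p t + δ₀ / 2 ∈ Icc (p t - δ₀ / 2) (p t + δ₀ / 2) := ⟨by linarith, by linarith⟩
  have hrp : r (p t) = p := hG.inj _ (hr _ hp_mem).1 _ hp fun s hs => by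
    rw [(hr _ hp_mem).2 s hs, Function.update_eq_self]
  have rinj : InjOn (fun x => r x h) (Icc (p t - δ₀ / 2) (p t + δ₀ / 2)) := by
    intro x hx y hy hxy
    have : r x = r y := by
      apply hinj _ (hr x hx).1 _ (hr y hy).1
      intro s hs
      rcases Finset.mem_insert.1 hs with rfl | hs
      · exact hxy
      · have := Finset.mem_erase.1 hs
        rw [(hr x hx).2 s this.2, (hr y hy).2 s this.2, Function.update_of_ne this.1,
          Function.update_of_ne this.1]
    have := congrFun this t
    simpa [(hr x hx).2 t ht, (hr y hy).2 t ht] using this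
  have offt : ∀ x ∈ Icc (p t - δ₀ / 2) (p t + δ₀ / 2), ∀ s ∈ H, s ≠ t → r x s = p s := by
    intro x hx s hs hst
    rw [(hr x hx).2 s hs, Function.update_of_ne hst]
  have near : ∀ x ∈ Icc (p t - δ₀ / 2) (p t + δ₀ / 2), |r x t - p t| < δ₀ := by
    intro x hx
    rw [(hr x hx).2 t ht, Function.update_self, abs_lt]
    constructor <;> linarith [hx.1, hx.2]
  have main : ∃ δ > 0, ∀ u : ι → ℝ, (∀ s ∈ H, s ≠ t → |u s - p s| < δ) → |u h - p h| < δ →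
      ∃ r ∈ G, (∀ s ∈ H, s ≠ t → r s = u s) ∧ r h = u h ∧ dist r p < ε := by
    rcases ((continuous_apply h).comp_continuousOn hrc).strictMonoOn_of_injOn_Icc'
      (by linarith) rinj with hm | hm
    · refine hG.exists_of_between ht hδ₀ hl (hr _ hl_mem).1 (hr _ hr_mem).1 (offt _ hl_mem)
        (offt _ hr_mem) (near _ hl_mem) (near _ hr_mem) ?_ ?_
      · have := hm hl_mem hp_mem (by linarith)
        simpa only [Function.comp_apply, hrp] using this
      · have := hm hp_mem hr_mem (by linarith)
        simpa only [Function.comp_apply, hrp] using this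
    · refine hG.exists_of_between ht hδ₀ hl (hr _ hr_mem).1 (hr _ hl_mem).1 (offt _ hr_mem)
        (offt _ hl_mem) (near _ hr_mem) (near _ hl_mem) ?_ ?_
      · have := hm hp_mem hr_mem (by linarith)
        simpa only [Function.comp_apply, hrp] using this
      · have := hm hl_mem hp_mem (by linarith)
        simpa only [Function.comp_apply, hrp] using this
  obtain ⟨δ, hδ, hm⟩ := main
  refine ⟨δ, hδ, fun u hu => ?_⟩
  obtain ⟨q, hq, hqu, hqh, hqd⟩ := hm u
    (fun s hs hst => hu s (Finset.mem_insert_of_mem (Finset.mem_erase.2 ⟨hst, hs⟩)))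
    (hu h (Finset.mem_insert_self _ _))
  refine ⟨q, hq, ?_, hqd⟩
  intro s hs
  rcases Finset.mem_insert.1 hs with rfl | hs
  · exact hqh
  · exact hqu s (Finset.mem_erase.1 hs).2 (Finset.mem_erase.1 hs).1

/-- Local dependence gives two points on a segment with different values of `h`; the box is centred
at the midpoint of these values. No injectivity is needed, which is what lets quasi-affinity supply
it. -/
theorem isFullDimensional_exchange (hG : IsChart H G) {t h : ι} (ht : t ∈ H) (hh : h ∉ H)
    (hdep : IsLocallyDependent H G h t) :
    IsFullDimensional ((insert h (H.erase t)).restrict '' G) := by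
  obtain ⟨p, hp, hq⟩ := hdep
  obtain ⟨δ₀, hδ₀, hl⟩ := hG.lift p hp 1 one_pos
  obtain ⟨q, hqG, hqp, hqt, hqh⟩ := hq δ₀ hδ₀
  have main : ∃ δ > 0, ∀ u : ι → ℝ, (∀ s ∈ H, s ≠ t → |u s - p s| < δ) →
      |u h - (p h + q h) / 2| < δ →
      ∃ r ∈ G, (∀ s ∈ H, s ≠ t → r s = u s) ∧ r h = u h ∧ dist r p < 1 := by
    rcases lt_or_gt_of_ne hqh with hlt | hlt
    · exact hG.exists_of_between ht hδ₀ hl hqG hp hqp (fun _ _ _ => rfl) hqt (by simpa using hδ₀)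
        (by linarith) (by linarith)
    · exact hG.exists_of_between ht hδ₀ hl hp hqG (fun _ _ _ => rfl) hqp (by simpa using hδ₀) hqt
        (by linarith) (by linarith)
  obtain ⟨δ, hδ, hm⟩ := main
  refine isFullDimensional_of_box (Function.update p h ((p h + q h) / 2)) hδ ?_
  intro u hu
  obtain ⟨r, hr, hru, hrh, -⟩ := hm u (fun s hs hst => by
      have := hu s (Finset.mem_insert_of_mem (Finset.mem_erase.2 ⟨hst, hs⟩))
      rwa [Function.update_of_ne (by rintro rfl; exact hh hs)] at this) (by
      have := hu h (Finset.mem_insert_self _ _)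
      rwa [Function.update_self] at this)
  refine ⟨r, hr, fun s hs => ?_⟩
  rcases Finset.mem_insert.1 hs with rfl | hs
  · exact hrh
  · exact hru s (Finset.mem_erase.1 hs).2 (Finset.mem_erase.1 hs).1

theorem slice {z : ι} (hz : z ∉ H) (hG : IsChart (insert z H) G) (b : ℝ) :
    IsChart H (G ∩ {p | p z = b}) := by
  constructor
  · rintro p ⟨hp, hpz⟩ q ⟨hq, hqz⟩ h
    refine hG.inj p hp q hq fun s hs => ?_
    rcases Finset.mem_insert.1 hs with rfl | hs
    · exact hpz.trans hqz.symm
    · exact h s hs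
  · rintro p ⟨hp, hpz⟩ ε hε
    obtain ⟨δ, hδ, hl⟩ := hG.lift p hp ε hε
    refine ⟨δ, hδ, fun u hu => ?_⟩
    obtain ⟨q, hq, hqu, hqd⟩ := hl (Function.update u z b) (by
      intro s hs
      rcases Finset.mem_insert.1 hs with rfl | hsH
      · rw [Function.update_self, ← (show p s = b from hpz)]; simpa using hδ
      · rw [Function.update_of_ne (by rintro rfl; exact hz hsH)]
        exact hu s hsH)
    refine ⟨q, ⟨hq, ?_⟩, fun s hs => ?_, hqd⟩
    · simpa using hqu z (Finset.mem_insert_self _ _)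
    · rw [hqu s (Finset.mem_insert_of_mem hs),
        Function.update_of_ne (by rintro rfl; exact hz hs)]

theorem isOpen_image (hG : IsChart H G) : IsOpen (H.restrict '' G) := by
  rw [isOpen_iff_mem_nhds]
  rintro _ ⟨p, hp, rfl⟩
  obtain ⟨δ, hδ, hl⟩ := hG.lift p hp 1 one_pos
  rw [Metric.mem_nhds_iff]
  refine ⟨δ, hδ, fun x hx => ?_⟩
  obtain ⟨r, hr, hru, -⟩ := hl (fun i => if hi : i ∈ H then x ⟨i, hi⟩ else 0) (by
    intro s hs
    simp only [hs, dif_pos]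
    exact lt_of_le_of_lt (dist_le_pi_dist x (H.restrict p) ⟨s, hs⟩) hx)
  refine ⟨r, hr, ?_⟩
  ext ⟨i, hi⟩
  have := hru i hi
  simpa [hi] using this

end IsChart

/-! ### Exchange systems and their contractions -/

/-- A system of charts of `G`, closed under the exchange of `t` for a coordinate that locally
depends on `t`. -/
structure IsExchangeSystem {ι : Type} [Fintype ι] [DecidableEq ι] (B : Set (Finset ι))
    (G : Set (ι → ℝ)) : Prop where
  chart : ∀ H ∈ B, IsChart H G
  exchange : ∀ H ∈ B, ∀ t ∈ H, ∀ h ∉ H, IsLocallyDependent H G h t → insert h (H.erase t) ∈ B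

/-- The contraction of a set system by the element `z`. -/
def contractSystem {ι : Type} [DecidableEq ι] (B : Set (Finset ι)) (z : ι) : Set (Finset ι) :=
  {H | z ∉ H ∧ insert z H ∈ B}

namespace IsExchangeSystem

variable {ι : Type} [Fintype ι] [DecidableEq ι] {B : Set (Finset ι)} {G : Set (ι → ℝ)}

/-- Since `z` is constant on the slice, local dependence over `H` there is local dependence over
`insert z H` on `G`, where the exchange is available. -/
theorem slice (hB : IsExchangeSystem B G) (z : ι) (b : ℝ) :
    IsExchangeSystem (contractSystem B z) (G ∩ {p | p z = b}) := by
  constructor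
  · rintro H ⟨hz, hH⟩
    exact (hB.chart _ hH).slice hz b
  · rintro H ⟨hz, hH⟩ t ht h hh ⟨p, ⟨hp, hpz⟩, hdep⟩
    have htz : t ≠ z := by rintro rfl; exact hz ht
    have hhz : h ≠ z := by
      rintro rfl
      obtain ⟨q, ⟨-, hqz⟩, -, -, hne⟩ := hdep 1 one_pos
      exact hne (hqz.trans hpz.symm)
    have := hB.exchange _ hH t (Finset.mem_insert_of_mem ht) h
      (by simp [hhz, hh]) ⟨p, hp, fun δ hδ => by
        obtain ⟨q, ⟨hq, hqz⟩, hqs, hqt, hqh⟩ := hdep δ hδ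
        refine ⟨q, hq, fun s hs hst => ?_, hqt, hqh⟩
        rcases Finset.mem_insert.1 hs with rfl | hs
        · exact (show q s = b from hqz).trans (show p s = b from hpz).symm
        · exact hqs s hs hst⟩
    refine ⟨by simp [hhz.symm, hz], ?_⟩
    rwa [Finset.erase_insert_of_ne htz.symm, Finset.insert_comm] at this

theorem erase_mem_contract (hB : IsExchangeSystem B G) {T : Finset ι} (hT : T ∈ B) {t z : ι}
    (ht : t ∈ T) (hz : z ∉ T) (hdep : IsLocallyDependent T G z t) :
    T.erase t ∈ contractSystem B z :=
  ⟨fun h => hz (Finset.mem_erase.1 h).2, hB.exchange T hT t ht z hz hdep⟩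

/-- If the projection to `span H` is injective, then one can exchange into `H`. -/
theorem exists_locallyDependent (hB : IsExchangeSystem B G) (hne : G.Nonempty) {D H : Finset ι}
    (hD : D ∈ B) (hinj : ∀ p ∈ G, ∀ q ∈ G, (∀ h ∈ H, p h = q h) → p = q) {t : ι} (ht : t ∈ D)
    (htH : t ∉ H) : ∃ h ∈ H, h ∉ D ∧ IsLocallyDependent D G h t := by
  by_contra! hcon
  obtain ⟨p, hp⟩ := hne
  -- Near `p`, moving along `t` changes no coordinate of `H`: those in `D` are fixed because `t ∉
  -- H`, the others are locally constant by `hcon`. Finiteness of `H` gives a common radius.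
  have h1 : ∀ᶠ r in 𝓝[>] (0 : ℝ), ∀ h ∈ H, ∀ q ∈ G, (∀ s ∈ D, s ≠ t → q s = p s) →
      |q t - p t| < r → q h = p h := by
    rw [Filter.eventually_all_finset]
    intro h hh
    by_cases hhD : h ∈ D
    · exact Eventually.of_forall fun r q _ hqs _ => hqs h hhD (by rintro rfl; exact htH hh)
    · have := hcon h hh hhD
      simp only [IsLocallyDependent, not_exists, not_and, not_forall] at this
      obtain ⟨δ, hδ, hq⟩ := this p hp
      filter_upwards [Ioo_mem_nhdsGT hδ] with r hr q hqG hqs hqt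
      by_contra hne
      exact hq q hqG hqs (hqt.trans hr.2) hne
  obtain ⟨r, hr, hr0⟩ := (h1.and self_mem_nhdsWithin).exists
  have hr0 : 0 < r := hr0
  obtain ⟨δ, hδ, hl⟩ := (hB.chart D hD).lift p hp 1 one_pos
  have hm : 0 < min δ r := lt_min hδ hr0
  obtain ⟨q, hq, hqu, -⟩ := hl (Function.update p t (p t + min δ r / 2)) (by
    intro s hs
    by_cases hst : s = t
    · subst hst
      rw [Function.update_self, add_sub_cancel_left, abs_of_pos (by linarith)]
      linarith [min_le_left δ r]
    · rw [Function.update_of_ne hst]; simpa using hδ)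
  have hqt := hqu t ht
  rw [Function.update_self] at hqt
  have : q = p := hinj q hq p hp fun h hh => hr h hh q hq
    (fun s hs hst => by rw [hqu s hs, Function.update_of_ne hst]) (by
      rw [hqt, add_sub_cancel_left, abs_of_pos (by linarith)]
      linarith [min_le_right δ r])
  rw [this] at hqt
  linarith

/-- Each exchange of some `t ∈ D \ H` for an element of `H` lowers the cardinality of `D \ H`. -/
theorem exists_subset (hB : IsExchangeSystem B G) (hne : G.Nonempty) {H : Finset ι}
    (hinj : ∀ p ∈ G, ∀ q ∈ G, (∀ h ∈ H, p h = q h) → p = q) {D : Finset ι} (hD : D ∈ B) :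
    ∃ D' ∈ B, D' ⊆ H ∧ D'.card = D.card := by
  induction hm : (D \ H).card using Nat.strong_induction_on generalizing D with
  | _ m ih =>
    by_cases hsub : D ⊆ H
    · exact ⟨D, hD, hsub, rfl⟩
    · obtain ⟨t, ht, htH⟩ := Finset.not_subset.1 hsub
      obtain ⟨h, hh, hhD, hdep⟩ := hB.exists_locallyDependent hne hD hinj ht htH
      have hlt : ((insert h (D.erase t)) \ H).card < m := by
        rw [← hm]
        apply Finset.card_lt_card
        rw [Finset.ssubset_iff_of_subset]
        · exact ⟨t, by simp [ht, htH], by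
            simp only [Finset.mem_sdiff, Finset.mem_insert, Finset.mem_erase]
            rintro ⟨rfl | h1, -⟩
            · exact hhD ht
            · exact h1.1 rfl⟩
        · intro s hs
          simp only [Finset.mem_sdiff, Finset.mem_insert, Finset.mem_erase] at hs ⊢
          rcases hs with ⟨rfl | hs, hsH⟩
          · exact absurd hh hsH
          · exact ⟨hs.2, hsH⟩
      obtain ⟨D', h1, h2, h3⟩ := ih _ hlt (hB.exchange D hD t ht h hhD hdep) rfl
      refine ⟨D', h1, h2, h3.trans ?_⟩
      rw [Finset.card_insert_of_notMem (fun h' => hhD (Finset.mem_erase.1 h').2),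
        Finset.card_erase_add_one ht]

theorem mem_of_injOn (hB : IsExchangeSystem B G) (hne : G.Nonempty) {H D : Finset ι}
    (hinj : ∀ p ∈ G, ∀ q ∈ G, (∀ h ∈ H, p h = q h) → p = q) (hD : D ∈ B)
    (hcard : H.card = D.card) : H ∈ B := by
  obtain ⟨D', h1, h2, h3⟩ := hB.exists_subset hne hinj hD
  rwa [Finset.eq_of_subset_of_card_le h2 (by omega)] at h1

/-- This serves for domains whose number of coordinates is not known beforehand. If the chart `D' ⊆
H` missed some `h ∈ H`, moving only `h` at an interior point would give two points of `G` that agree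
on `D'`. -/
theorem mem_of_isFullDimensional (hB : IsExchangeSystem B G) {H D : Finset ι}
    (hinj : ∀ p ∈ G, ∀ q ∈ G, (∀ h ∈ H, p h = q h) → p = q) (hD : D ∈ B)
    (hdim : IsFullDimensional (H.restrict '' G)) : H ∈ B := by
  obtain ⟨x, hx⟩ := hdim
  have hne : G.Nonempty := image_nonempty.1 ⟨x, interior_subset hx⟩
  obtain ⟨D', h1, h2, -⟩ := hB.exists_subset hne hinj hD
  have : D' = H := by
    refine h2.antisymm fun h hh => ?_
    by_contra hhD
    rw [mem_interior_iff_mem_nhds, Metric.mem_nhds_iff] at hx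
    obtain ⟨ε, hε, hball⟩ := hx
    obtain ⟨p, hp, hpx⟩ := hball (Metric.mem_ball_self hε)
    obtain ⟨q, hq, hqx⟩ := hball
      (show Function.update x ⟨h, hh⟩ (x ⟨h, hh⟩ + ε / 2) ∈ Metric.ball x ε by
        rw [Metric.mem_ball, dist_pi_lt_iff hε]
        intro i
        by_cases hi : i = ⟨h, hh⟩
        · subst hi
          rw [Function.update_self, Real.dist_eq, add_sub_cancel_left, abs_of_pos (by linarith)]
          linarith
        · rw [Function.update_of_ne hi, dist_self]
          exact hε)
    have hpq : p = q := (hB.chart D' h1).inj p hp q hq fun s hs => by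
      have hsh : (⟨s, h2 hs⟩ : H) ≠ ⟨h, hh⟩ := fun e => hhD (by
        have := congrArg Subtype.val e
        simp only at this
        rwa [← this])
      have a := congrFun hpx ⟨s, h2 hs⟩
      have b := congrFun hqx ⟨s, h2 hs⟩
      rw [Function.update_of_ne hsh] at b
      exact a.trans b.symm
    have a := congrFun hpx ⟨h, hh⟩
    have b := congrFun hqx ⟨h, hh⟩
    rw [Function.update_self, ← hpq, a] at b
    linarith
  rwa [← this]

end IsExchangeSystem

/-! ### Connected intersections with coordinate cones -/

/-- The coordinate cone given by the signs `σ` of `x_j - c_j`, `j ∈ J`. -/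
def coneSet {ι : Type} (J : Finset ι) (σ : ι → SignType) (c : ι → ℝ) : Set (ι → ℝ) :=
  {x | ∀ j ∈ J, SignType.sign (x j - c j) = σ j}

/-- The intersections of `G` with the coordinate cones given by conditions on the coordinates
in `T` are connected. -/
def IsConeConnected {ι : Type} (T : Finset ι) (G : Set (ι → ℝ)) : Prop :=
  ∀ J ⊆ T, ∀ σ c, IsPreconnected (G ∩ coneSet J σ c)

section

variable {ι : Type} {T : Finset ι} {G : Set (ι → ℝ)}

theorem IsConeConnected.isPreconnected (h : IsConeConnected T G) : IsPreconnected G := by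
  have := h ∅ (Finset.empty_subset _) 0 0
  rwa [show coneSet (∅ : Finset ι) 0 0 = univ by simp [coneSet], inter_univ] at this

theorem IsConeConnected.mono {S : Finset ι} (h : IsConeConnected T G) (hS : S ⊆ T) :
    IsConeConnected S G := fun J hJ => h J (hJ.trans hS)

theorem IsConeConnected.of_subsingleton (h : G.Subsingleton) : IsConeConnected T G :=
  fun _ _ _ _ => (h.anti inter_subset_left).isPreconnected

theorem IsConeConnected.empty : IsConeConnected T (∅ : Set (ι → ℝ)) :=
  .of_subsingleton subsingleton_empty

theorem IsConeConnected.isPreconnected_restrict (h : IsConeConnected T G)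
    {C : Set (T → ℝ)} (hC : IsCoordinateCone C) : IsPreconnected (T.restrict '' G ∩ C) := by
  obtain ⟨J, σ, c, rfl⟩ := hC
  have := (h (J.map (Function.Embedding.subtype _)) (by
    intro j hj
    obtain ⟨i, -, rfl⟩ := Finset.mem_map.1 hj
    exact i.2) (fun i => by classical exact if hi : i ∈ T then σ ⟨i, hi⟩ else 0)
    (fun i => by classical exact if hi : i ∈ T then c ⟨i, hi⟩ else 0)).image
    (T.restrict (π := fun _ => ℝ)) (by
      apply Continuous.continuousOn
      exact continuous_pi fun i => continuous_apply _)
  convert this using 1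
  ext x
  constructor
  · rintro ⟨⟨p, hp, rfl⟩, hx⟩
    refine ⟨p, ⟨hp, ?_⟩, rfl⟩
    intro j hj
    obtain ⟨i, hi, rfl⟩ := Finset.mem_map.1 hj
    simpa using hx i hi
  · rintro ⟨p, ⟨hp, hx⟩, rfl⟩
    refine ⟨⟨p, hp, rfl⟩, fun i hi => ?_⟩
    simpa using hx i (Finset.mem_map_of_mem _ hi)

/-- The inverse of a chart is continuous, so connectedness lifts from the image to `G`. -/
theorem isConeConnected_of_restrict [Fintype ι] (hG : IsChart T G)
    (h : ∀ C : Set (T → ℝ), IsCoordinateCone C → IsPreconnected (T.restrict '' G ∩ C)) :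
    IsConeConnected T G := by
  intro J hJ σ c
  classical
  have h1 := h _ ⟨J.subtype (· ∈ T), fun i => σ i, fun i => c i, rfl⟩
  have hinv : ∀ x ∈ T.restrict (π := fun _ => ℝ) '' G,
      Function.invFunOn (T.restrict (π := fun _ => ℝ)) G x ∈ G ∧
      T.restrict (π := fun _ => ℝ) (Function.invFunOn (T.restrict (π := fun _ => ℝ)) G x) = x :=
    fun x hx => Function.invFunOn_pos hx
  have hc : ContinuousOn (Function.invFunOn (T.restrict (π := fun _ => ℝ)) G)
      (T.restrict (π := fun _ => ℝ) '' G) := by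
    apply hG.continuousOn fun x hx => (hinv x hx).1
    intro t ht
    exact (continuous_apply (⟨t, ht⟩ : T)).continuousOn.congr
      fun x hx => congrFun (hinv x hx).2 ⟨t, ht⟩
  convert h1.image _ (hc.mono inter_subset_left) using 1
  have hcone : ∀ p : ι → ℝ, T.restrict (π := fun _ => ℝ) p ∈ {x : T → ℝ | ∀ j ∈ J.subtype (· ∈ T),
      SignType.sign (x j - c j) = σ j} ↔ p ∈ coneSet J σ c := by
    intro p
    constructor
    · intro h j hj
      exact h ⟨j, hJ hj⟩ (by simpa using hj)
    · intro h j hj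
      exact h j (by simpa using hj)
  ext p
  constructor
  · rintro ⟨hp, hpc⟩
    have hx := hinv _ (mem_image_of_mem (T.restrict (π := fun _ => ℝ)) hp)
    exact ⟨T.restrict p, ⟨mem_image_of_mem _ hp, (hcone p).2 hpc⟩,
      hG.inj _ hx.1 p hp (finset_restrict_eq_iff.1 hx.2)⟩
  · rintro ⟨x, ⟨hx, hxc⟩, rfl⟩
    refine ⟨(hinv x hx).1, (hcone _).1 ?_⟩
    rwa [(hinv x hx).2]

theorem isSemiMonotone_restrict [Fintype ι] [DecidableEq ι] (hG : IsChart T G)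
    (hb : Bornology.IsBounded G) (h : IsConeConnected T G) :
    IsSemiMonotone (T.restrict '' G) := by
  refine ⟨hG.isOpen_image, ?_, fun C hC => h.isPreconnected_restrict hC⟩
  have : LipschitzWith 1 (T.restrict (π := fun _ => ℝ)) := by
    refine LipschitzWith.of_dist_le_mul fun p q => ?_
    rw [NNReal.coe_one, one_mul, dist_pi_le_iff dist_nonneg]
    exact fun i => dist_le_pi_dist p q i
  exact this.isBounded_image hb

theorem IsConeConnected.inter_sign [DecidableEq ι] (h : IsConeConnected T G) {S : Finset ι} {z : ι}
    (hS : S ⊆ T) (hz : z ∈ T) (hzS : z ∉ S) (b : ℝ) (s : SignType) :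
    IsConeConnected S (G ∩ {p | SignType.sign (p z - b) = s}) := by
  intro J hJ σ c
  have := h (insert z J) (Finset.insert_subset hz (hJ.trans hS)) (Function.update σ z s)
    (Function.update c z b)
  convert this using 1
  rw [inter_assoc]
  congr 1
  have hne : ∀ j ∈ J, j ≠ z := by rintro j hj rfl; exact hzS (hJ hj)
  ext p
  simp only [coneSet, mem_inter_iff, mem_ofPred_eq, Finset.forall_mem_insert,
    Function.update_self]
  refine and_congr_right fun _ => forall₂_congr fun j hj => ?_
  rw [Function.update_of_ne (hne j hj), Function.update_of_ne (hne j hj)]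

theorem setOf_apply_eq (z : ι) (b : ℝ) :
    {p : ι → ℝ | p z = b} = {p | SignType.sign (p z - b) = 0} := by
  ext p
  simp [sign_eq_zero_iff, sub_eq_zero]

theorem IsConeConnected.slice_erase [DecidableEq ι] (h : IsConeConnected T G) {z : ι}
    (hz : z ∈ T) (b : ℝ) :
    IsConeConnected (T.erase z) (G ∩ {p | p z = b}) := by
  rw [setOf_apply_eq]
  exact h.inter_sign (Finset.erase_subset _ _) hz (Finset.notMem_erase _ _) b 0

/-- A condition on a coordinate that is constant on `K` either is void or has no solution. -/
theorem isPreconnected_inter_of_const {K : Set (ι → ℝ)} (hK : IsPreconnected K) {z : ι}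
    (hz : ∀ p ∈ K, ∀ q ∈ K, p z = q z) (b : ℝ) (s : SignType) :
    IsPreconnected (K ∩ {p | SignType.sign (p z - b) = s}) := by
  rcases (K ∩ {p | SignType.sign (p z - b) = s}).eq_empty_or_nonempty with h | ⟨p, hp, hps⟩
  · rw [h]; exact isPreconnected_empty
  · rwa [inter_eq_left.2]
    intro q hq
    rw [mem_ofPred_eq, hz q hq p hp]
    exact hps

theorem coneSet_eq_inter [DecidableEq ι] {J : Finset ι} {z : ι} (hz : z ∈ J) (σ : ι → SignType)
    (c : ι → ℝ) :
    coneSet J σ c = coneSet (J.erase z) σ c ∩ {p | SignType.sign (p z - c z) = σ z} := by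
  ext p
  constructor
  · intro h
    exact ⟨fun j hj => h j (Finset.mem_erase.1 hj).2, h z hz⟩
  · rintro ⟨h1, h2⟩ j hj
    by_cases hjz : j = z
    · subst hjz; exact h2
    · exact h1 j (Finset.mem_erase.2 ⟨hjz, hj⟩)

theorem IsConeConnected.slice [DecidableEq ι] (h : IsConeConnected T G) {z : ι}
    (hz : z ∈ T) (b : ℝ) : IsConeConnected T (G ∩ {p | p z = b}) := by
  intro J hJ σ c
  have h1 := h.slice_erase hz b
  by_cases hzJ : z ∈ J
  · rw [coneSet_eq_inter hzJ, ← inter_assoc]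
    apply isPreconnected_inter_of_const
    · exact h1 _ (Finset.erase_subset_erase _ hJ) σ c
    · rintro p ⟨⟨-, hp⟩, -⟩ q ⟨⟨-, hq⟩, -⟩
      exact (show p z = b from hp).trans (show q z = b from hq).symm
  · exact h1 J (Finset.subset_erase.2 ⟨hJ, hzJ⟩) σ c

/-- An open function with connected fibres pulls open intervals back to connected sets. -/
theorem IsPreconnected.inter_preimage_of_fibres {E : Type*} [TopologicalSpace E] {K : Set E}
    (hK : IsPreconnected K) {φ : E → ℝ} (hφ : Continuous φ)
    (hfib : ∀ b, IsPreconnected (K ∩ φ ⁻¹' {b}))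
    (hopen : ∀ p ∈ K, ∀ U ∈ 𝓝 p, φ '' (K ∩ U) ∈ 𝓝 (φ p)) {I : Set ℝ} (hI : IsOpen I)
    (hIc : I.OrdConnected) : IsPreconnected (K ∩ φ ⁻¹' I) := by
  have himg : ∀ u : Set E, IsOpen u → IsOpen (φ '' (K ∩ φ ⁻¹' I ∩ u)) := by
    intro u hu
    rw [isOpen_iff_mem_nhds]
    rintro _ ⟨p, ⟨⟨hpK, hpI⟩, hpu⟩, rfl⟩
    have := hopen p hpK (φ ⁻¹' I ∩ u) (((hI.preimage hφ).inter hu).mem_nhds ⟨hpI, hpu⟩)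
    rwa [← inter_assoc] at this
  have hconn : IsPreconnected (φ '' (K ∩ φ ⁻¹' I)) := by
    have h1 : (φ '' K).OrdConnected := (hK.image φ hφ.continuousOn).ordConnected
    rw [image_inter_preimage]
    exact (h1.inter hIc).isPreconnected
  -- The images of the two open pieces are open and cover a connected set, so they share a value
  -- `b`. The connected fibre over `b` then meets both pieces.
  intro u v hu hv hcov ⟨p, hp, hpu⟩ ⟨q, hq, hqv⟩
  obtain ⟨b, hb, ⟨p', hp', hpb⟩, q', hq', hqb⟩ := hconn _ _ (himg u hu) (himg v hv) (by
      rintro _ ⟨r, hr, rfl⟩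
      rcases hcov hr with h | h
      · exact Or.inl ⟨r, ⟨hr, h⟩, rfl⟩
      · exact Or.inr ⟨r, ⟨hr, h⟩, rfl⟩)
    ⟨φ p, ⟨p, hp, rfl⟩, p, ⟨hp, hpu⟩, rfl⟩ ⟨φ q, ⟨q, hq, rfl⟩, q, ⟨hq, hqv⟩, rfl⟩
  have hbI : b ∈ I := hpb ▸ hp'.1.2
  have hsub : K ∩ φ ⁻¹' {b} ⊆ K ∩ φ ⁻¹' I := by
    rintro r ⟨hr, hrb⟩
    exact ⟨hr, by rw [mem_preimage, show φ r = b from hrb]; exact hbI⟩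
  obtain ⟨r, hr, hruv⟩ := hfib b u v hu hv (hsub.trans hcov) ⟨p', ⟨hp'.1.1, hpb⟩, hp'.2⟩
    ⟨q', ⟨hq'.1.1, hqb⟩, hq'.2⟩
  exact ⟨r, hsub hr, hruv⟩

theorem isOpen_and_ordConnected_sign (b : ℝ) {s : SignType} (hs : s ≠ 0) :
    IsOpen {x : ℝ | SignType.sign (x - b) = s} ∧ {x : ℝ | SignType.sign (x - b) = s}.OrdConnected := by
  cases s with
  | zero => exact absurd rfl hs
  | neg =>
    have : {x : ℝ | SignType.sign (x - b) = SignType.neg} = Iio b := by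
      ext x
      rw [mem_ofPred_eq, mem_Iio, ← sub_neg, ← sign_eq_neg_one_iff]
      rfl
    rw [this]
    exact ⟨isOpen_Iio, ordConnected_Iio⟩
  | pos =>
    have : {x : ℝ | SignType.sign (x - b) = SignType.pos} = Ioi b := by
      ext x
      rw [mem_ofPred_eq, mem_Ioi, ← sub_pos, ← sign_eq_one_iff]
      rfl
    rw [this]
    exact ⟨isOpen_Ioi, ordConnected_Ioi⟩

theorem isOpen_coneSet {J : Finset ι} {σ : ι → SignType} (hσ : ∀ j ∈ J, σ j ≠ 0) (c : ι → ℝ) :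
    IsOpen (coneSet J σ c) := by
  have : coneSet J σ c = ⋂ j ∈ J, (fun p : ι → ℝ => p j) ⁻¹' {x | SignType.sign (x - c j) = σ j} := by
    ext p; simp [coneSet]
  rw [this]
  exact isOpen_biInter_finset fun j hj =>
    (isOpen_and_ordConnected_sign (c j) (hσ j hj)).1.preimage (continuous_apply j)

end

/-! ### From the cones of one chart to all cones -/

section

variable {ι : Type} [Fintype ι] [DecidableEq ι] {T : Finset ι} {G : Set (ι → ℝ)}

/-- The lines parallel to a coordinate axis meet the image of `G` in connected sets, so a
coordinate that is locally constant along them is constant along them. -/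
theorem eq_of_not_isLocallyDependent (hT : IsConeConnected T G) {t z : ι}
    (hdep : ¬ IsLocallyDependent T G z t) {p q : ι → ℝ} (hp : p ∈ G) (hq : q ∈ G)
    (h : ∀ s ∈ T, s ≠ t → q s = p s) : q z = p z := by
  have hK := hT (T.erase t) (Finset.erase_subset _ _) 0 p
  have hmem : ∀ r, r ∈ G ∩ coneSet (T.erase t) 0 p ↔ r ∈ G ∧ ∀ s ∈ T, s ≠ t → r s = p s := by
    intro r
    simp only [coneSet, mem_inter_iff, mem_ofPred_eq, Pi.zero_apply, sign_eq_zero_iff, sub_eq_zero,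
      Finset.mem_erase]
    exact and_congr_right fun _ => ⟨fun h s hs hst => h s ⟨hst, hs⟩, fun h s hs => h s hs.2 hs.1⟩
  refine hK.induction₂ (fun x y => y z = x z) ?_ (fun x y w _ _ _ h1 h2 => h2.trans h1)
    (fun x y _ _ h1 => h1.symm) ((hmem p).2 ⟨hp, fun _ _ _ => rfl⟩) ((hmem q).2 ⟨hq, h⟩)
  intro x hx
  have hx' := (hmem x).1 hx
  simp only [IsLocallyDependent, not_exists, not_and, not_forall] at hdep
  obtain ⟨δ, hδ, hd⟩ := hdep x hx'.1
  filter_upwards [self_mem_nhdsWithin, mem_nhdsWithin_of_mem_nhds (Metric.ball_mem_nhds x hδ)]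
    with y hy hyd
  have hy' := (hmem y).1 hy
  by_contra hne
  exact hd y hy'.1 (fun s hs hst => (hy'.2 s hs hst).trans (hx'.2 s hs hst).symm)
    (lt_of_le_of_lt (dist_le_pi_dist y x t) hyd) hne

/-- Otherwise changing the coordinates of `T` one at a time inside a small box shows that `z` is
locally constant, hence constant on the connected set `G`. -/
theorem exists_isLocallyDependent (hG : IsChart T G) (hT : IsConeConnected T G) {z : ι}
    {p q : ι → ℝ} (hp : p ∈ G) (hq : q ∈ G) (hpq : p z ≠ q z) :
    ∃ t ∈ T, IsLocallyDependent T G z t := by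
  by_contra! hcon
  refine hpq (hT.isPreconnected.induction₂ (fun x y => y z = x z) ?_
    (fun x y w _ _ _ h1 h2 => h2.trans h1) (fun x y _ _ h1 => h1.symm) hq hp)
  intro x hx
  obtain ⟨δ, hδ, hl⟩ := hG.lift x hx 1 one_pos
  -- `S` contains the coordinates of `T` in which `y` may differ from `x`; resetting one of them to
  -- its value at `x` stays inside the box, so a lift exists.
  have claim : ∀ S ⊆ T, ∀ y ∈ G, (∀ s ∈ T, |y s - x s| < δ) → (∀ s ∈ T, s ∉ S → y s = x s) →
      y z = x z := by
    intro S
    induction S using Finset.induction_on with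
    | empty =>
      intro _ y hy _ h
      rw [hG.inj y hy x hx fun s hs => h s hs (Finset.notMem_empty _)]
    | insert t S htS ih =>
      intro hS y hy hyδ h
      obtain ⟨y', hy', hyu, -⟩ := hl (Function.update y t (x t)) (by
        intro s hs
        by_cases hst : s = t
        · subst hst; simpa using hδ
        · rw [Function.update_of_ne hst]; exact hyδ s hs)
      have h1 : y' z = x z := by
        refine ih ((Finset.subset_insert _ _).trans hS) y' hy' (fun s hs => ?_) fun s hs hsS => ?_
        · rw [hyu s hs]
          by_cases hst : s = t
          · subst hst; simpa using hδ
          · rw [Function.update_of_ne hst]; exact hyδ s hs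
        · rw [hyu s hs]
          by_cases hst : s = t
          · subst hst; simp
          · rw [Function.update_of_ne hst]
            exact h s hs (by simp [hst, hsS])
      rw [← h1]
      refine eq_of_not_isLocallyDependent hT (hcon t (hS (Finset.mem_insert_self _ _))) hy' hy ?_
      intro s hs hst
      rw [hyu s hs, Function.update_of_ne hst]
  filter_upwards [self_mem_nhdsWithin, mem_nhdsWithin_of_mem_nhds (Metric.ball_mem_nhds x hδ)]
    with y hy hyd
  exact claim T subset_rfl y hy (fun s _ => lt_of_le_of_lt (dist_le_pi_dist y x s) hyd)
    fun s hs hsT => absurd hs hsT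

/-- If the image of `G` in `span T` has connected intersections with coordinate cones and so do
the level sets of the other coordinates, then so does `G`. -/
theorem isConeConnected_univ {B : Set (Finset ι)} (hB : IsExchangeSystem B G) (hTB : T ∈ B)
    (hT : IsConeConnected T G)
    (hlev : ∀ z ∉ T, (∃ p ∈ G, ∃ q ∈ G, p z ≠ q z) →
      ∀ b, IsConeConnected Finset.univ (G ∩ {p | p z = b})) :
    IsConeConnected Finset.univ G := by
  induction hn : T.card generalizing T G B with
  | zero =>
    obtain rfl := Finset.card_eq_zero.1 hn
    exact .of_subsingleton fun p hp q hq => (hB.chart _ hTB).inj p hp q hq (by simp)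
  | succ n ih =>
    have hslice : ∀ t ∈ T, ∀ b, IsConeConnected Finset.univ (G ∩ {p | p t = b}) := by
      intro t ht b
      refine ih (hB.slice t b) (T := T.erase t) ⟨Finset.notMem_erase _ _, ?_⟩
        (hT.slice_erase ht b) ?_ (by rw [Finset.card_erase_of_mem ht, hn]; rfl)
      · rwa [Finset.insert_erase ht]
      · rintro z hz ⟨p, ⟨hp, hpt⟩, q, ⟨hq, hqt⟩, hpq⟩ b'
        have hzt : z ≠ t := by
          rintro rfl
          exact hpq ((show p z = b from hpt).trans (show q z = b from hqt).symm)
        rw [inter_right_comm]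
        exact (hlev z (fun h => hz (Finset.mem_erase.2 ⟨hzt, h⟩)) ⟨p, hp, q, hq, hpq⟩ b').slice
          (Finset.mem_univ _) b
    intro J _ σ c
    -- An inner induction on the number of conditions of the cone.
    induction hm : J.card using Nat.strong_induction_on generalizing J with
    | _ m ihm =>
      have herase : ∀ z ∈ J, IsPreconnected (G ∩ coneSet (J.erase z) σ c) := fun z hz =>
        ihm _ (by rw [← hm]; exact Finset.card_erase_lt_of_mem hz) _ (Finset.subset_univ _) rfl
      by_cases hex : ∃ z ∈ J, (∀ p ∈ G, ∀ q ∈ G, p z = q z) ∨ σ z = 0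
      · obtain ⟨z, hz, hcase⟩ := hex
        by_cases hconst : ∀ p ∈ G, ∀ q ∈ G, p z = q z
        · rw [coneSet_eq_inter hz, ← inter_assoc]
          exact isPreconnected_inter_of_const (herase z hz)
            (fun p hp q hq => hconst p hp.1 q hq.1) _ _
        · have hσ := hcase.resolve_left hconst
          push Not at hconst
          have hcc : IsConeConnected Finset.univ (G ∩ {p | p z = c z}) := by
            by_cases hzT : z ∈ T
            · exact hslice z hzT _
            · exact hlev z hzT hconst _
          have := hcc (J.erase z) (Finset.subset_univ _) σ c
          rw [coneSet_eq_inter hz, hσ, ← setOf_apply_eq, inter_comm (coneSet _ _ _), ← inter_assoc]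
          exact this
      -- Only strict conditions on non-constant coordinates remain, so the cone is open.
      · push Not at hex
        by_cases hJT : J ⊆ T
        · exact hT J hJT σ c
        · obtain ⟨z, hz, hzT⟩ := Finset.not_subset.1 hJT
          rw [coneSet_eq_inter hz, ← inter_assoc]
          obtain ⟨⟨p, hp, q, hq, hpq⟩, hσ⟩ := hex z hz
          obtain ⟨t, ht, hdep⟩ := exists_isLocallyDependent (hB.chart T hTB) hT hp hq hpq
          have hchart := hB.chart _ (hB.exchange T hTB t ht z hzT hdep)
          have hI := isOpen_and_ordConnected_sign (c z) hσ
          refine (herase z hz).inter_preimage_of_fibres (continuous_apply z) ?_ ?_ hI.1 hI.2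
          · intro b
            have := hlev z hzT ⟨p, hp, q, hq, hpq⟩ b (J.erase z) (Finset.subset_univ _) σ c
            rwa [inter_right_comm] at this
          -- The coordinate `z` belongs to a chart, so it can be moved freely near `x` while the
          -- other, open conditions persist.
          · rintro x ⟨hx, hxc⟩ U hU
            have hU' : U ∩ coneSet (J.erase z) σ c ∈ 𝓝 x := inter_mem hU
              ((isOpen_coneSet (fun j hj => (hex j (Finset.mem_erase.1 hj).2).2) c).mem_nhds hxc)
            obtain ⟨ε, hε, hball⟩ := Metric.mem_nhds_iff.1 hU'
            obtain ⟨δ, hδ, hl⟩ := hchart.lift x hx ε hε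
            rw [Metric.mem_nhds_iff]
            refine ⟨δ, hδ, fun v hv => ?_⟩
            obtain ⟨y, hy, hyu, hyd⟩ := hl (Function.update x z v) (by
              intro s hs
              by_cases hsz : s = z
              · subst hsz; rwa [Function.update_self]
              · rw [Function.update_of_ne hsz]; simpa using hδ)
            have := hball hyd
            refine ⟨y, ⟨⟨hy, this.2⟩, this.1⟩, ?_⟩
            simpa using hyu z (Finset.mem_insert_self _ _)

end

/-! ### Monotone graphs and cone-connectedness -/

section

variable {ι : Type} [DecidableEq ι] {D E : Finset ι} {G : Set (ι → ℝ)}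

theorem IsGraphOfMap.apply_eq {f : (D → ℝ) → (E → ℝ)} (hf : IsGraphOfMap D E f G) {p : ι → ℝ}
    (hp : p ∈ G) (i : E) : f (D.restrict p) i = p i :=
  (congrFun (hf.2.1 p hp) i).symm

theorem IsGraphOfMap.inj {f : (D → ℝ) → (E → ℝ)} (hf : IsGraphOfMap D E f G) :
    ∀ p ∈ G, ∀ q ∈ G, (∀ h ∈ D, p h = q h) → p = q := by
  intro p hp q hq h
  ext i
  by_cases hD : i ∈ D
  · exact h i hD
  by_cases hE : i ∈ E
  · rw [← hf.apply_eq hp ⟨i, hE⟩, ← hf.apply_eq hq ⟨i, hE⟩, finset_restrict_eq_iff.2 h]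
  · exact hf.2.2 p hp q hq i (by simp [hD, hE])

theorem IsGraphOfMap.not_isIndependentOf {f : (D → ℝ) → (E → ℝ)} (hf : IsGraphOfMap D E f G)
    {i : E} {j : D} (hdep : IsLocallyDependent D G i j) :
    ¬ IsIndependentOf (D.restrict '' G) (fun x => f x i) j := by
  intro hind
  obtain ⟨p, hp, h⟩ := hdep
  obtain ⟨q, hq, hqs, -, hne⟩ := h 1 one_pos
  have := hind (D.restrict q) ⟨q, hq, rfl⟩ (D.restrict p) ⟨p, hp, rfl⟩
    (fun l hl => hqs l l.2 fun h => hl (Subtype.ext h))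
  simp only [hf.apply_eq hq, hf.apply_eq hp] at this
  exact hne this

theorem IsGraphOfMap.isIndependentOf [Fintype ι] {f : (D → ℝ) → (E → ℝ)} (hf : IsGraphOfMap D E f G)
    (hG : IsConeConnected D G)
    {i : E} {j : D} (hdep : ¬ IsLocallyDependent D G i j) :
    IsIndependentOf (D.restrict '' G) (fun x => f x i) j := by
  rintro _ ⟨p, hp, rfl⟩ _ ⟨q, hq, rfl⟩ h
  simp only [hf.apply_eq hq, hf.apply_eq hp]
  exact eq_of_not_isLocallyDependent hG hdep hq hp
    fun s hs hst => h ⟨s, hs⟩ fun h => hst (congrArg Subtype.val h)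

theorem IsMonotoneGraphAux.exists_isGraphOfMap {n : ℕ} (h : IsMonotoneGraphAux n D E G) :
    ∃ f : (D → ℝ) → (E → ℝ), IsGraphOfMap D E f G := by
  match n, h with
  | 0, ⟨f, hf, _⟩ => exact ⟨f, hf⟩
  | 1, ⟨f, hf, _⟩ => exact ⟨f, hf⟩
  | n + 2, ⟨f, hf, _⟩ => exact ⟨f, hf⟩

theorem IsMonotoneGraphAux.isSemiMonotone {n : ℕ} (h : IsMonotoneGraphAux (n + 1) D E G) :
    IsSemiMonotone (D.restrict '' G) := by
  match n, h with
  | 0, ⟨_, _, _, hs, _⟩ => exact hs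
  | n + 1, ⟨_, _, _, hs, _⟩ => exact hs

theorem IsMonotoneGraph.isFullDimensional (h : IsMonotoneGraph D E G) (hne : G.Nonempty) :
    IsFullDimensional (D.restrict '' G) := by
  have hne' : (D.restrict (π := fun _ => ℝ) '' G).Nonempty := hne.image _
  rcases D.eq_empty_or_nonempty with rfl | hD
  · rwa [IsFullDimensional, Subsingleton.eq_univ_of_nonempty hne', interior_univ,
      ← Subsingleton.eq_univ_of_nonempty hne']
  · obtain ⟨n, hn⟩ := Nat.exists_eq_succ_of_ne_zero hD.card_pos.ne'
    rw [IsMonotoneGraph, hn] at h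
    rwa [IsFullDimensional, h.isSemiMonotone.1.interior_eq]

variable [Fintype ι]

/-- The graph of a monotone map has connected intersections with all coordinate cones. -/
theorem IsMonotoneGraphAux.isConeConnected {n : ℕ} {B : Set (Finset ι)}
    (h : IsMonotoneGraphAux n D E G) (hB : IsExchangeSystem B G) (hD : D ∈ B) (hn : D.card = n) :
    IsConeConnected Finset.univ G := by
  induction n generalizing D E G B with
  | zero =>
    obtain rfl := Finset.card_eq_zero.1 hn
    exact .of_subsingleton fun p hp q hq => (hB.chart _ hD).inj p hp q hq (by simp)
  | succ n ih =>
    have hDc : IsConeConnected D G :=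
      isConeConnected_of_restrict (hB.chart D hD) h.isSemiMonotone.2.2
    refine isConeConnected_univ hB hD hDc ?_
    rintro z hz ⟨p, hp, q, hq, hpq⟩ b
    obtain ⟨t, ht, hdep⟩ := exists_isLocallyDependent (hB.chart D hD) hDc hp hq hpq
    have hmem := hB.erase_mem_contract hD ht hz hdep
    have hcard : (D.erase t).card = n := by rw [Finset.card_erase_of_mem ht, hn]; rfl
    have hBz := hB.slice z b
    -- Over a one-dimensional domain the definition has no clause on level sets, but the contracted
    -- chart is empty, so each level set has at most one point.
    rcases n with _ | n
    · have := hBz.chart _ hmem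
      rw [Finset.card_eq_zero.1 hcard] at this
      exact .of_subsingleton fun p hp q hq => this.inj p hp q hq (by simp)
    · obtain ⟨f, hf, -, -, -, -, hstep⟩ := h
      rcases (G ∩ {p | p z = b}).eq_empty_or_nonempty with he | hne
      · rw [he]; exact .empty
      · have hzE : z ∈ E := by
          by_contra hzE
          exact hpq (hf.2.2 p hp q hq z (by simp [hz, hzE]))
        exact ih ((hstep ⟨z, hzE⟩ ⟨t, ht⟩ (hf.not_isIndependentOf hdep)).1 b hne) hBz hmem hcard

/-- A pair violating each alternative would lie in a common compact interval, where a continuous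
injective function is strictly monotone. -/
theorem ContinuousOn.strictMonoOn_or_strictAntiOn {A : Set ℝ} (hA : A.OrdConnected) {g : ℝ → ℝ}
    (hg : ContinuousOn g A) (hi : InjOn g A) : StrictMonoOn g A ∨ StrictAntiOn g A := by
  by_contra! hcon
  simp only [StrictMonoOn, StrictAntiOn, not_forall, not_lt] at hcon
  obtain ⟨⟨x, hx, y, hy, hxy, h1⟩, x', hx', y', hy', hxy', h2⟩ := hcon
  have hsub : Icc (min x x') (max y y') ⊆ A := by
    apply hA.out
    · rcases min_choice x x' with h | h <;> rwa [h]
    · rcases max_choice y y' with h | h <;> rwa [h]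
  have mx : x ∈ Icc (min x x') (max y y') := ⟨min_le_left _ _, hxy.le.trans (le_max_left _ _)⟩
  have my : y ∈ Icc (min x x') (max y y') := ⟨(min_le_left _ _).trans hxy.le, le_max_left _ _⟩
  have mx' : x' ∈ Icc (min x x') (max y y') := ⟨min_le_right _ _, hxy'.le.trans (le_max_right _ _)⟩
  have my' : y' ∈ Icc (min x x') (max y y') := ⟨(min_le_right _ _).trans hxy'.le, le_max_right _ _⟩
  rcases ContinuousOn.strictMonoOn_of_injOn_Icc' (mx.1.trans mx.2) (hg.mono hsub)
    (hi.mono hsub) with h | h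
  · exact absurd (h mx my hxy) (not_lt.2 h1)
  · exact absurd (h mx' my' hxy') (not_lt.2 h2)

/-- Over a one-dimensional domain, a coordinate with injective projection is strictly monotone. -/
theorem IsGraphOfMap.strictly_of_singleton {f : (D → ℝ) → (E → ℝ)} (hf : IsGraphOfMap D E f G)
    (hG : IsChart D G) (hGc : IsConeConnected D G) {i : E} {j : D} (hD : D = {(j : ι)})
    (hinj : ∀ p ∈ G, ∀ q ∈ G, p i = q i → p = q) :
    IsStrictlyIncreasingIn (D.restrict '' G) (fun x => f x i) j ∨
      IsStrictlyDecreasingIn (D.restrict '' G) (fun x => f x i) j := by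
  set A : Set ℝ := (fun p : ι → ℝ => p j) '' G with hA
  have hAc : A.OrdConnected :=
    (hGc.isPreconnected.image _ (continuous_apply (j : ι)).continuousOn).ordConnected
  have key : ∀ x ∈ A, ∃ p ∈ G, p j = x := fun x hx => hx
  choose! r hrG hrj using key
  have hr : ∀ p ∈ G, r (p j) = p := by
    intro p hp
    apply hG.inj _ (hrG _ ⟨p, hp, rfl⟩) p hp
    intro h hh
    rw [hD, Finset.mem_singleton] at hh
    subst hh
    exact hrj _ ⟨p, hp, rfl⟩
  have hrc : ContinuousOn r A := by
    apply hG.continuousOn hrG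
    intro h hh
    rw [hD, Finset.mem_singleton] at hh
    subst hh
    exact continuousOn_id.congr hrj
  have hri : InjOn (fun x => r x i) A := by
    intro x hx y hy hxy
    rw [← hrj x hx, ← hrj y hy, hinj _ (hrG x hx) _ (hrG y hy) hxy]
  refine (ContinuousOn.strictMonoOn_or_strictAntiOn hAc
    ((continuous_apply (i : ι)).comp_continuousOn hrc) hri).imp ?_ ?_ <;>
  · rintro hm _ ⟨p, hp, rfl⟩ _ ⟨q, hq, rfl⟩ - hlt
    have := hm (mem_image_of_mem _ hp) (mem_image_of_mem _ hq) hlt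
    simp only [Function.comp_apply, hr p hp, hr q hq] at this
    simpa only [hf.apply_eq hp, hf.apply_eq hq] using this

theorem exists_isGraphOfMap (hG : IsChart D G) (hdisj : Disjoint D E)
    (hconst : ∀ p ∈ G, ∀ q ∈ G, ∀ c, c ∉ D ∪ E → p c = q c) :
    ∃ f : (D → ℝ) → (E → ℝ), IsGraphOfMap D E f G ∧ ContinuousOn f (D.restrict '' G) := by
  have hinv : ∀ x ∈ D.restrict (π := fun _ => ℝ) '' G,
      Function.invFunOn (D.restrict (π := fun _ => ℝ)) G x ∈ G ∧
      D.restrict (π := fun _ => ℝ) (Function.invFunOn (D.restrict (π := fun _ => ℝ)) G x) = x :=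
    fun x hx => Function.invFunOn_pos hx
  have hc : ContinuousOn (Function.invFunOn (D.restrict (π := fun _ => ℝ)) G)
      (D.restrict (π := fun _ => ℝ) '' G) := by
    apply hG.continuousOn fun x hx => (hinv x hx).1
    intro t ht
    exact (continuous_apply (⟨t, ht⟩ : D)).continuousOn.congr
      fun x hx => congrFun (hinv x hx).2 ⟨t, ht⟩
  refine ⟨fun x => E.restrict (Function.invFunOn (D.restrict (π := fun _ => ℝ)) G x),
    ⟨hdisj, fun p hp => ?_, hconst⟩, ?_⟩
  · have := hinv (D.restrict p) (mem_image_of_mem _ hp)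
    simp only [hG.inj _ this.1 p hp (finset_restrict_eq_iff.1 this.2)]
  · exact (continuous_pi fun i : E => continuous_apply (i : ι)).comp_continuousOn hc

/-- A sublevel set of `f_i` is the projection of `G` cut by a strict condition on the coordinate
`i`. Intersecting it with a cone over `D` is thus a cone condition in the larger space. -/
theorem IsGraphOfMap.isSubmonotone {f : (D → ℝ) → (E → ℝ)} (hf : IsGraphOfMap D E f G)
    (hfc : ContinuousOn f (D.restrict '' G)) (hne : G.Nonempty) (hG : IsChart D G)
    (hb : Bornology.IsBounded G) (hGc : IsConeConnected Finset.univ G) (i : E) :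
    IsSubmonotone (D.restrict '' G) (fun x => f x i) ∧
      IsSupermonotone (D.restrict '' G) (fun x => f x i) := by
  have hs := isSemiMonotone_restrict hG hb (hGc.mono (Finset.subset_univ D))
  have hfic : ContinuousOn (fun x => f x i) (D.restrict '' G) :=
    (continuous_apply i).comp_continuousOn hfc
  have hbdd : Bornology.IsBounded ((fun x => f x i) '' (D.restrict '' G)) := by
    have : LipschitzWith 1 (fun p : ι → ℝ => p i) := LipschitzWith.eval (i : ι)
    have h := this.isBounded_image hb
    rwa [image_congr fun p hp => (hf.apply_eq hp i).symm, ← image_image (fun x => f x i)] at h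
  have hiD : (i : ι) ∉ D := fun h => Finset.disjoint_left.1 hf.1 h i.2
  have hcone : ∀ (b : ℝ) (s : SignType) (C : Set (D → ℝ)), IsCoordinateCone C →
      IsPreconnected ({x ∈ D.restrict '' G | SignType.sign (f x i - b) = s} ∩ C) := by
    intro b s C hC
    convert (hGc.inter_sign (Finset.subset_univ D) (Finset.mem_univ (i : ι)) hiD
      b s).isPreconnected_restrict hC using 2
    ext x
    constructor
    · rintro ⟨⟨p, hp, rfl⟩, hx⟩
      rw [hf.apply_eq hp] at hx
      exact ⟨p, ⟨hp, hx⟩, rfl⟩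
    · rintro ⟨p, ⟨hp, hx⟩, rfl⟩
      refine ⟨⟨p, hp, rfl⟩, ?_⟩
      rw [hf.apply_eq hp]
      exact hx
  refine ⟨⟨hne.image _, hs, hbdd, hfic.upperSemicontinuousOn, fun b => ⟨?_, ?_, ?_⟩⟩,
    ⟨hne.image _, hs, ?_, hfic.neg.upperSemicontinuousOn, fun b => ⟨?_, ?_, ?_⟩⟩⟩
  · exact hfic.isOpen_inter_preimage hs.1 isOpen_Iio
  · exact hs.2.1.subset (sep_subset _ _)
  · intro C hC
    convert hcone b (-1) C hC using 4
    rw [sign_eq_neg_one_iff, sub_neg]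
  · rw [← image_image (fun x => -x) (fun x => f x i)]
    exact LipschitzWith.isBounded_image (LipschitzWith.id.neg) hbdd
  · exact hfic.neg.isOpen_inter_preimage hs.1 isOpen_Iio
  · exact hs.2.1.subset (sep_subset _ _)
  · intro C hC
    convert hcone (-b) 1 C hC using 4
    rw [sign_eq_one_iff, sub_pos, neg_lt]

/-- A bounded set with an exchange system of charts and connected intersections with all
coordinate cones is the graph of a monotone map over each of its charts. -/
theorem isMonotoneGraphAux_of_isConeConnected {n : ℕ} {B : Set (Finset ι)}
    (hB : IsExchangeSystem B G) (hD : D ∈ B) (hn : D.card = n) (hne : G.Nonempty)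
    (hb : Bornology.IsBounded G) (hGc : IsConeConnected Finset.univ G) (hdisj : Disjoint D E)
    (hconst : ∀ p ∈ G, ∀ q ∈ G, ∀ c, c ∉ D ∪ E → p c = q c) :
    IsMonotoneGraphAux n D E G := by
  induction n generalizing D E G B with
  | zero =>
    obtain ⟨f, hf, -⟩ := exists_isGraphOfMap (hB.chart D hD) hdisj hconst
    exact ⟨f, hf, hne.image _⟩
  | succ n ih =>
    have hchart := hB.chart D hD
    have hGD := hGc.mono (Finset.subset_univ D)
    obtain ⟨f, hf, hfc⟩ := exists_isGraphOfMap hchart hdisj hconst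
    have hs := isSemiMonotone_restrict hchart hb hGD
    have hbdd : Bornology.IsBounded (f '' (D.restrict '' G)) := by
      have : LipschitzWith 1 (E.restrict (π := fun _ => ℝ)) := by
        refine LipschitzWith.of_dist_le_mul fun p q => ?_
        rw [NNReal.coe_one, one_mul, dist_pi_le_iff dist_nonneg]
        exact fun i => dist_le_pi_dist p q i
      have h := this.isBounded_image hb
      rwa [image_congr hf.2.1, ← image_image] at h
    have hiD : ∀ i : E, (i : ι) ∉ D := fun i h => Finset.disjoint_left.1 hdisj h i.2
    rcases n with _ | n
    · refine ⟨f, hf, hne.image _, hs, hfc, hbdd, fun i => ?_⟩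
      have hsub := hf.isSubmonotone hfc hne hchart hb hGc i
      refine ⟨hsub.1, hsub.2, fun j => ?_⟩
      by_cases hdep : IsLocallyDependent D G i j
      · obtain ⟨t, rfl⟩ := Finset.card_eq_one.1 hn
        have hj : (j : ι) = t := Finset.mem_singleton.1 j.2
        have hi := (hB.chart _ (hB.exchange _ hD j j.2 i (hiD i) hdep)).inj
        rw [← or_assoc]
        refine Or.inl (hf.strictly_of_singleton hchart hGD (by rw [hj]) fun p hp q hq hpq => ?_)
        refine hi p hp q hq fun s hs => ?_
        rw [hj] at hs
        simp only [Finset.erase_singleton, insert_empty_eq, Finset.mem_singleton] at hs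
        rw [hs]; exact hpq
      · exact Or.inr (Or.inr (hf.isIndependentOf hGD hdep))
    · refine ⟨f, hf, hne.image _, hs, hfc, hbdd, fun i j hnind => ?_⟩
      have hdep : IsLocallyDependent D G i j := by
        by_contra h
        exact hnind (hf.isIndependentOf hGD h)
      have hmem := hB.erase_mem_contract hD j.2 (hiD i) hdep
      have hcard : (D.erase j).card = n + 1 := by rw [Finset.card_erase_of_mem j.2, hn]; rfl
      constructor
      · intro b hneb
        refine ih (hB.slice i b) hmem hcard hneb (hb.subset inter_subset_left)
          (hGc.slice (Finset.mem_univ _) b) ?_ ?_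
        · rw [Finset.disjoint_insert_right]
          exact ⟨Finset.notMem_erase _ _,
            hdisj.mono (Finset.erase_subset _ _) (Finset.erase_subset _ _)⟩
        · rintro p ⟨hp, hpi⟩ q ⟨hq, hqi⟩ c hc
          by_cases hci : c = i
          · rw [hci]; exact (show p i = b from hpi).trans (show q i = b from hqi).symm
          · apply hconst p hp q hq c
            intro h
            apply hc
            rcases Finset.mem_union.1 h with h | h
            · by_cases hcj : c = j
              · simp [hcj]
              · simp [hcj, h]
            · simp [h, hci]
      -- The basis sets of a slice are the members of the contracted system with the required
      -- coordinates and cardinality, a description free of `b`.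
      · have key : ∀ b : ℝ, (G ∩ {p | p i = b}).Nonempty →
            basisSets (D.erase j) (insert (j : ι) (E.erase i)) (G ∩ {p | p i = b}) =
            {H | H ⊆ D.erase j ∪ insert (j : ι) (E.erase i) ∧ H.card = (D.erase j).card ∧
              H ∈ contractSystem B i} := by
          intro b hneb
          ext H
          refine and_congr_right fun _ => and_congr_right fun hc => ?_
          rw [injOn_restrict_iff]
          exact ⟨fun h => (hB.slice i b).mem_of_injOn hneb h hmem hc,
            fun h => ((hB.slice i b).chart H h).inj⟩
        intro b b' h h'
        rw [key b h, key b' h']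

end

/-! ### The graph of a quasi-affine map -/

section

variable {n k : ℕ} {X : Set (Fin n → ℝ)} {f : (Fin n → ℝ) → (Fin k → ℝ)}

theorem isChart_mapGraph (hX : IsOpen X) (hf : ContinuousOn f X) :
    IsChart (Finset.univ.map Function.Embedding.inl) (mapGraph X f) := by
  constructor
  · rintro _ ⟨x, hx, rfl⟩ _ ⟨y, hy, rfl⟩ h
    have : x = y := by
      ext j
      simpa using h (Sum.inl j) (by simp)
    rw [this]
  · rintro _ ⟨x, hx, rfl⟩ ε hε
    have hc : ContinuousAt f x := hf.continuousAt (hX.mem_nhds hx)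
    obtain ⟨δ, hδ, h⟩ := Metric.mem_nhds_iff.1
      (inter_mem (hX.mem_nhds hx) (inter_mem (Metric.ball_mem_nhds x hε)
        (hc (Metric.ball_mem_nhds (f x) hε))))
    refine ⟨δ, hδ, fun u hu => ?_⟩
    have hmem : (fun j => u (Sum.inl j)) ∈ Metric.ball x δ := by
      rw [Metric.mem_ball, dist_pi_lt_iff hδ]
      intro j
      simpa [Real.dist_eq] using hu (Sum.inl j) (by simp)
    obtain ⟨h1, h2, h3⟩ := h hmem
    refine ⟨_, ⟨_, h1, rfl⟩, ?_, ?_⟩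
    · intro s hs
      obtain ⟨j, -, rfl⟩ := Finset.mem_map.1 hs
      rfl
    · rw [dist_pi_lt_iff hε]
      rintro (j | i)
      · exact lt_of_le_of_lt (dist_le_pi_dist (fun j => u (Sum.inl j)) x j) h2
      · exact lt_of_le_of_lt (dist_le_pi_dist (f fun j => u (Sum.inl j)) (f x) i) h3

theorem isBounded_mapGraph (hX : Bornology.IsBounded X) (hf : Bornology.IsBounded (f '' X)) :
    Bornology.IsBounded (mapGraph X f) := by
  obtain ⟨R, hR⟩ := hX.exists_norm_le
  obtain ⟨R', hR'⟩ := hf.exists_norm_le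
  rw [isBounded_iff_forall_norm_le]
  refine ⟨max R R', ?_⟩
  rintro _ ⟨x, hx, rfl⟩
  have h1 := hR x hx
  have h2 := hR' _ (mem_image_of_mem f hx)
  rw [pi_norm_le_iff_of_nonneg (le_max_of_le_left ((norm_nonneg x).trans h1))]
  rintro (j | i)
  · exact (norm_le_pi_norm x j).trans (h1.trans (le_max_left _ _))
  · exact (norm_le_pi_norm (f x) i).trans (h2.trans (le_max_right _ _))

/-- The charts of the graph of a quasi-affine map form an exchange system. -/
theorem IsQuasiAffine.isExchangeSystem (hqa : IsQuasiAffine X f) :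
    IsExchangeSystem {H | H.card = n ∧ IsChart H (mapGraph X f)} (mapGraph X f) := by
  refine ⟨fun H hH => hH.2, ?_⟩
  rintro H ⟨hc, hH⟩ t ht h hh hdep
  have hcard : (insert h (H.erase t)).card = n := by
    rw [Finset.card_insert_of_notMem (fun h' => hh (Finset.mem_erase.1 h').2),
      Finset.card_erase_add_one ht, hc]
  exact ⟨hcard, hH.exchange ht (injOn_restrict_iff.1
    ((hqa _ hcard).2 (hH.isFullDimensional_exchange ht hh hdep)))⟩

end

section

variable {ι : Type} [Fintype ι] {H T : Finset ι} {G : Set (ι → ℝ)}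

theorem IsChart.exists_ne (hG : IsChart H G) (hne : G.Nonempty) {h : ι} (hh : h ∈ H) :
    ∃ p ∈ G, ∃ q ∈ G, p h ≠ q h := by
  obtain ⟨p, hp⟩ := hne
  obtain ⟨δ, hδ, hl⟩ := hG.lift p hp 1 one_pos
  obtain ⟨q, hq, hqu, -⟩ := hl (fun s => p s + δ / 2) (fun s _ => by
    rw [add_sub_cancel_left, abs_of_pos (by linarith)]; linarith)
  refine ⟨p, hp, q, hq, ?_⟩
  rw [hqu h hh]
  linarith

/-- The level sets of a non-constant coordinate are graphs of monotone maps. -/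
theorem IsConeConnected.isGraphOfMonotoneMapIn [DecidableEq ι] {B : Set (Finset ι)} (hB : IsExchangeSystem B G)
    (hT : T ∈ B) (hb : Bornology.IsBounded G) (hGc : IsConeConnected Finset.univ G) {z : ι}
    (hz : z ∉ T) (hnc : ∃ p ∈ G, ∃ q ∈ G, p z ≠ q z) {a : ℝ} (hne : (G ∩ {p | p z = a}).Nonempty) :
    IsGraphOfMonotoneMapIn (Finset.univ.erase z) (G ∩ {p | p z = a}) := by
  obtain ⟨p, hp, q, hq, hpq⟩ := hnc
  obtain ⟨t, ht, hdep⟩ := exists_isLocallyDependent (hB.chart T hT)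
    (hGc.mono (Finset.subset_univ T)) hp hq hpq
  have hsub : T.erase t ⊆ Finset.univ.erase z := fun s hs => by
    refine Finset.mem_erase.2 ⟨?_, Finset.mem_univ s⟩
    rintro rfl
    exact hz (Finset.mem_erase.1 hs).2
  refine ⟨T.erase t, hsub, isMonotoneGraphAux_of_isConeConnected (hB.slice z a)
    (hB.erase_mem_contract hT ht hz hdep) rfl hne (hb.subset inter_subset_left)
    (hGc.slice (Finset.mem_univ z) a) Finset.disjoint_sdiff ?_⟩
  rintro x ⟨-, hx⟩ y ⟨-, hy⟩ c hc
  have hcz : c = z := by simpa [Finset.union_sdiff_of_subset hsub] using hc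
  rw [hcz]
  exact (show x z = a from hx).trans (show y z = a from hy).symm

end

/-- `Z` is the set of the `k` chosen coordinates, `T = Zᶜ` the set of the remaining `n`. -/
theorem theorem4p9 (S : OMinimalStructure) (n k : ℕ) (X : Set (Fin n → ℝ))
    (f : (Fin n → ℝ) → (Fin k → ℝ))
    (hX : IsSemiMonotone X) (hXne : X.Nonempty)
    (hdef : S.IsDefinableMap X f)
    (hcont : ContinuousOn f X) (hbdd : Bornology.IsBounded (f '' X))
    (hqa : IsQuasiAffine X f)
    (Z : Finset (Fin n ⊕ Fin k)) (hZ : Z.card = k)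
    (hdim : IsFullDimensional (Zᶜ.restrict '' mapGraph X f)) :
    IsMonotoneMap X f ↔
      IsSemiMonotone (Zᶜ.restrict '' mapGraph X f) ∧
      (∀ j : Fin n, Sum.inl j ∈ Z →
        ∀ a : ℝ, (mapGraph X f ∩ {p | p (Sum.inl j) = a}).Nonempty →
          IsGraphOfMonotoneMapIn (Finset.univ.erase (Sum.inl j))
            (mapGraph X f ∩ {p | p (Sum.inl j) = a})) ∧
      (∀ i : Fin k, Sum.inr i ∈ Z →
        (∃ t ∈ Zᶜ, ¬ IsIndependentOver Zᶜ (mapGraph X f) (Sum.inr i) t) →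
        ∀ a : ℝ, (mapGraph X f ∩ {p | p (Sum.inr i) = a}).Nonempty →
          IsGraphOfMonotoneMapIn (Finset.univ.erase (Sum.inr i))
            (mapGraph X f ∩ {p | p (Sum.inr i) = a})) := by
  have hB := hqa.isExchangeSystem
  set G := mapGraph X f with hG
  have hne : G.Nonempty := let ⟨x, hx⟩ := hXne; ⟨_, x, hx, rfl⟩
  have hb : Bornology.IsBounded G := isBounded_mapGraph hX.2.1 hbdd
  have hD : (Finset.univ.map Function.Embedding.inl : Finset (Fin n ⊕ Fin k)) ∈
      {H : Finset (Fin n ⊕ Fin k) | H.card = n ∧ IsChart H G} :=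
    ⟨by simp, isChart_mapGraph hX.1 hcont⟩
  have hTcard : (Zᶜ).card = n := by
    rw [Finset.card_compl, hZ]; simp
  have hT := hB.mem_of_injOn hne (injOn_restrict_iff.1 ((hqa _ hTcard).2 hdim)) hD
    (hTcard.trans hD.1.symm)
  constructor
  · intro hm
    have hGc : IsConeConnected Finset.univ G :=
      IsMonotoneGraphAux.isConeConnected hm hB hD rfl
    refine ⟨isSemiMonotone_restrict hT.2 hb (hGc.mono (Finset.subset_univ _)), ?_, ?_⟩
    -- The coordinate `x_j` lies in the chart of domain coordinates, so it is never constant on `G`.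
    · intro j hj a hnea
      exact hGc.isGraphOfMonotoneMapIn hB hT hb (by simpa using hj)
        (hD.2.exists_ne hne (by simp)) hnea
    · rintro i hi ⟨t, ht, hind⟩ a hnea
      simp only [IsIndependentOver, not_forall] at hind
      obtain ⟨p, hp, q, hq, -, hpq⟩ := hind
      exact hGc.isGraphOfMonotoneMapIn hB hT hb (by simpa using hi) ⟨p, hp, q, hq, hpq⟩ hnea
  · rintro ⟨hs, hx, hy⟩
    have hTc := isConeConnected_of_restrict hT.2 hs.2.2
    have hGc : IsConeConnected Finset.univ G := by
      refine isConeConnected_univ hB hT hTc ?_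
      rintro z hz ⟨p, hp, q, hq, hpq⟩ b
      obtain ⟨t, ht, hdep⟩ := exists_isLocallyDependent hT.2 hTc hp hq hpq
      rcases (G ∩ {p | p z = b}).eq_empty_or_nonempty with he | hneb
      · rw [he]; exact .empty
      have hzZ : z ∈ Z := by simpa using hz
      have hgr : IsGraphOfMonotoneMapIn (Finset.univ.erase z) (G ∩ {p | p z = b}) := by
        rcases z with j | i
        · exact hx j hzZ b hneb
        -- Local dependence on `t` refutes independence of `t`, so condition 2 applies to `y_i`.
        · refine hy i hzZ ⟨t, ht, fun hind => ?_⟩ b hneb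
          obtain ⟨x, hxG, h⟩ := hdep
          obtain ⟨y, hyG, hys, -, hyne⟩ := h 1 one_pos
          exact hyne (hind y hyG x hxG hys)
      obtain ⟨D, hDz, hm⟩ := hgr
      obtain ⟨g, hg⟩ := IsMonotoneGraphAux.exists_isGraphOfMap hm
      have hBz := hB.slice z b
      -- The division given by the hypothesis is arbitrary, but its domain projection is injective
      -- and full-dimensional, so `D` belongs to the contracted system.
      exact IsMonotoneGraphAux.isConeConnected hm hBz (hBz.mem_of_isFullDimensional hg.inj
        (hB.erase_mem_contract hT ht hz hdep) (hm.isFullDimensional hneb)) rfl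
    refine isMonotoneGraphAux_of_isConeConnected hB hD rfl hne hb hGc ?_ ?_
    · rw [Finset.disjoint_left]
      rintro (j | i) <;> simp
    · rintro p - q - (j | i) hc <;> simp at hc
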